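/- Let $X$ be the space of real-valued $u\in H^1(\mathbb R^2)$ with $\int_{\mathbb R^2}\log(1+|x|)\,u(x)^2\,dx<\infty$, with scalar product $$\langle u\mid v\rangle_X=\int_{\mathbb R^2}(\nabla u\cdot\nabla v+uv)\,dx+\int_{\mathbb R^2}\log(1+|x|)\,u(x)v(x)\,dx .$$ Define $I\colon X\to\mathbb R$ by $$I(u)=\frac12\int_{\mathbb R^2}(|\nabla u|^2+u^2)\,dx+\frac1{8\pi}\int_{\mathbb R^2\times\mathbb R^2}\log|x-y|\,u(x)^2u(y)^2\,dx\,dy ,$$ and $B(f,g)=-\frac1{2\pi}\int_{\mathbb R^2\times\mathbb R^2}\log|x-y|\,f(x)g(y)\,dx\,dy$. Let $u\in X$ be a positive (a.e.) weak solution of $$-\Delta u+u=\frac1{2\pi}\Bigl[\log\frac1{|\cdot|}\star u^2\Bigr]u\qquad\text{in }\mathbb R^2 .$$ Then: 1. For all $f,g,h,k\in X$ the function $(x,y)\mapsto\log|x-y|\,f(x)g(x)\,h(y)k(y)$ is integrable on $\mathbb R^2\times\mathbb R^2$. The functional $I$ is of class $C^2$ on $X$, and for all $\varphi,\psi\in X$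 $$I''(u)[\varphi,\psi]=\int_{\mathbb R^2}(\nabla\varphi\cdot\nabla\psi+\varphi\psi)\,dx-B(u^2,\varphi\psi)-2B(u\varphi,u\psi).$$ 2. $I''(u)\colon X\to X^*$ is a Fredholm operator of index zero. 3. $I''(u)=A+K$ with bounded linear operators $A,K\colon X\to X^*$ such that, with $c^2=\frac1{2\pi}\int_{\mathbb R^2}u^2\,dx$, for all $\varphi,\psi\in X$ $$\langle A\varphi,\psi\rangle=\int_{\mathbb R^2}\bigl(\nabla\varphi\cdot\nabla\psi+\varphi\psi+c^2\log(1+|x|)\,\varphi\psi\bigr)\,dx,$$ $$\langle K\varphi,\psi\rangle=\frac1{2\pi}\int_{\mathbb R^2\times\mathbb R^2}\bigl[\log|x-y|-\log(1+|x|)\bigr]u(y)^2\varphi(x)\psi(x)\,dx\,dy+\frac1\pi\int_{\mathbb R^2\times\mathbb R^2}\log|x-y|\,u(y)\varphi(y)\,u(x)\psi(x)\,dx\,dy .$$ The operator $A$ is coercive, i.e. $\langle A\varphi,\varphi\rangle\ge\alpha\|\varphi\|_X^2$ for some $\alpha>0$ and all $\varphi\in X$, and invertible with bounded inverse; the operator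 $K$ is compact. -/

import Mathlib

open MeasureTheory Set Filter
open scoped ContDiff InnerProductSpace

noncomputable section

namespace LogChoquard

/-- The plane `ℝ²` with its Euclidean norm and Lebesgue measure. -/
abbrev Plane : Type := EuclideanSpace ℝ (Fin 2)

/-- `G` is the weak gradient of `f` on `ℝ²`: `∫ f ∇φ = - ∫ φ G` for every test function `φ`. -/
def HasWeakGradient (f : Plane → ℝ) (G : Plane → Plane) : Prop :=
  ∀ φ : Plane → ℝ, ContDiff ℝ ∞ φ → HasCompactSupport φ →
    ∫ x, f x • gradient φ x = - ∫ x, φ x • G x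

/-- `f ∈ H¹(ℝ²)` (the function and its weak gradient are in `L²`), real-valued. -/
def MemH1 (f : Plane → ℝ) : Prop :=
  MemLp f 2 volume ∧ ∃ G : Plane → Plane, MemLp G 2 volume ∧ HasWeakGradient f G

/-- `f ∈ X`: `f ∈ H¹(ℝ²)` and `∫ log (1 + |x|) |f(x)|² dx < ∞`. -/
def MemX (f : Plane → ℝ) : Prop :=
  MemH1 f ∧ Integrable (fun x => Real.log (1 + ‖x‖) * f x ^ 2) volume

lemma log_weight_nonneg (x : Plane) : 0 ≤ Real.log (1 + ‖x‖) :=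
  Real.log_nonneg (by linarith [norm_nonneg x])

lemma measurable_log_weight : Measurable (fun x : Plane => Real.log (1 + ‖x‖)) :=
  Real.measurable_log.comp (measurable_const.add measurable_norm)

lemma integrable_smul_gradient {f φ : Plane → ℝ} (hf : MemLp f 2 volume)
    (hφ : ContDiff ℝ ∞ φ) (hc : HasCompactSupport φ) :
    Integrable (fun x => f x • gradient φ x) volume := by
  have hcont : Continuous (gradient φ) := by
    have : Continuous (fderiv ℝ φ) := hφ.continuous_fderiv (by simp)
    exact (InnerProductSpace.toDual ℝ Plane).symm.continuous.comp this
  have hsupp : HasCompactSupport (gradient φ) :=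
    (hc.fderiv (𝕜 := ℝ)).comp_left (g := (InnerProductSpace.toDual ℝ Plane).symm) (map_zero _)
  exact (hf.locallyIntegrable (by norm_num)).integrable_smul_right_of_hasCompactSupport hcont hsupp

lemma integrable_smul_field {G : Plane → Plane} {φ : Plane → ℝ} (hG : MemLp G 2 volume)
    (hφ : ContDiff ℝ ∞ φ) (hc : HasCompactSupport φ) :
    Integrable (fun x => φ x • G x) volume :=
  (hG.locallyIntegrable (by norm_num)).integrable_smul_left_of_hasCompactSupport hφ.continuous hc

lemma HasWeakGradient.ae_unique {f g : Plane → ℝ} {F G : Plane → Plane}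
    (hF : HasWeakGradient f F) (hG : HasWeakGradient g G) (hfg : f =ᵐ[volume] g)
    (hF2 : MemLp F 2 volume) (hG2 : MemLp G 2 volume) : F =ᵐ[volume] G := by
  refine ae_eq_of_integral_contDiff_smul_eq (hF2.locallyIntegrable (by norm_num))
    (hG2.locallyIntegrable (by norm_num)) fun φ hφ hc => ?_
  have h : ∫ x, f x • gradient φ x = ∫ x, g x • gradient φ x :=
    integral_congr_ae (hfg.mono fun x hx => by simp [hx])
  have := hF φ hφ hc
  have := hG φ hφ hc
  exact neg_injective (by simp_all)

lemma HasWeakGradient.congr {f g : Plane → ℝ} {F : Plane → Plane}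
    (hF : HasWeakGradient f F) (hfg : f =ᵐ[volume] g) : HasWeakGradient g F := by
  intro φ hφ hc
  rw [← hF φ hφ hc]
  exact integral_congr_ae (hfg.mono fun x hx => by simp [hx])

lemma HasWeakGradient.add {f g : Plane → ℝ} {F G : Plane → Plane}
    (hF : HasWeakGradient f F) (hG : HasWeakGradient g G)
    (hf : MemLp f 2 volume) (hg : MemLp g 2 volume)
    (hF2 : MemLp F 2 volume) (hG2 : MemLp G 2 volume) : HasWeakGradient (f + g) (F + G) := by
  intro φ hφ hc
  simp only [Pi.add_apply, add_smul, smul_add]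
  rw [integral_add (integrable_smul_gradient hf hφ hc) (integrable_smul_gradient hg hφ hc),
    integral_add (integrable_smul_field hF2 hφ hc) (integrable_smul_field hG2 hφ hc),
    hF φ hφ hc, hG φ hφ hc, neg_add]

lemma HasWeakGradient.const_smul {f : Plane → ℝ} {F : Plane → Plane}
    (hF : HasWeakGradient f F) (c : ℝ) : HasWeakGradient (c • f) (c • F) := by
  intro φ hφ hc
  simp only [Pi.smul_apply, smul_eq_mul, mul_smul, smul_comm _ c]
  rw [integral_smul, integral_smul, hF φ hφ hc, smul_neg]

lemma MemX.congr {f g : Plane → ℝ} (hf : MemX f) (hfg : f =ᵐ[volume] g) : MemX g := by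
  obtain ⟨⟨h2, F, hF2, hF⟩, hw⟩ := hf
  refine ⟨⟨h2.ae_eq hfg, F, hF2, hF.congr hfg⟩, hw.congr ?_⟩
  exact hfg.mono fun x hx => by simp [hx]

lemma integrable_log_mul {f g : Plane → ℝ} (hf : MemX f) (hg : MemX g) :
    Integrable (fun x => Real.log (1 + ‖x‖) * (f x * g x)) volume := by
  refine (hf.2.add hg.2).mono' (measurable_log_weight.aestronglyMeasurable.mul
    (hf.1.1.aestronglyMeasurable.mul hg.1.1.aestronglyMeasurable)) (Eventually.of_forall fun x => ?_)
  have h0 := log_weight_nonneg x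
  simp only [Pi.add_apply, norm_mul, Real.norm_eq_abs, abs_of_nonneg h0]
  rw [← mul_add]
  refine mul_le_mul_of_nonneg_left ?_ h0
  rw [← sq_abs (f x), ← sq_abs (g x)]
  nlinarith [sq_nonneg (|f x| - |g x|), abs_nonneg (f x), abs_nonneg (g x)]

lemma MemX.add {f g : Plane → ℝ} (hf : MemX f) (hg : MemX g) : MemX (f + g) := by
  have hfg := integrable_log_mul hf hg
  obtain ⟨⟨f2, F, hF2, hF⟩, fw⟩ := hf
  obtain ⟨⟨g2, G, hG2, hG⟩, gw⟩ := hg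
  refine ⟨⟨f2.add g2, F + G, hF2.add hG2, hF.add hG f2 g2 hF2 hG2⟩, ?_⟩
  refine ((fw.add gw).add (hfg.const_mul 2)).congr (Eventually.of_forall fun x => ?_)
  simp only [Pi.add_apply]
  ring

lemma MemX.const_smul {f : Plane → ℝ} (hf : MemX f) (c : ℝ) : MemX (c • f) := by
  obtain ⟨⟨f2, F, hF2, hF⟩, fw⟩ := hf
  refine ⟨⟨f2.const_smul c, c • F, hF2.const_smul c, hF.const_smul c⟩, ?_⟩
  refine (fw.const_mul (c ^ 2)).congr (Eventually.of_forall fun x => ?_)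
  simp only [Pi.smul_apply, smul_eq_mul]
  ring

/-- The elements of `L²(ℝ²)` that lie in `X`, as a linear subspace. -/
def XSubmodule : Submodule ℝ (Lp ℝ 2 (volume : Measure Plane)) where
  carrier := {f | MemX f}
  add_mem' {f g} hf hg := (MemX.add hf hg).congr (Lp.coeFn_add f g).symm
  zero_mem' := by
    have h : MemX (fun _ : Plane => (0 : ℝ)) :=
      ⟨⟨MemLp.zero', 0, MemLp.zero, fun φ _ _ => by simp⟩, by simp⟩
    exact h.congr (Lp.coeFn_zero ℝ 2 volume).symm
  smul_mem' c f hf := (MemX.const_smul hf c).congr (Lp.coeFn_smul c f).symm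

/-- The space `X` of (classes of) functions `u ∈ H¹(ℝ²)` with `∫ log (1 + |x|) |u|² < ∞`.
It is a separate type because it carries its own inner product, not that of `L²`. -/
def X : Type := XSubmodule

namespace X

instance : AddCommGroup X := inferInstanceAs (AddCommGroup XSubmodule)

instance : Module ℝ X := inferInstanceAs (Module ℝ XSubmodule)

/-- The class in `L²(ℝ²)` of an element of `X`. -/
def toL2 (u : X) : Lp ℝ 2 (volume : Measure Plane) := Subtype.val u

instance : CoeFun X (fun _ => Plane → ℝ) := ⟨fun u => u.toL2⟩

lemma memX (u : X) : MemX u := Subtype.property u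

lemma memLp (u : X) : MemLp u 2 volume := u.memX.1.1

lemma coe_add (u v : X) : (u + v : X) =ᵐ[volume] (u : Plane → ℝ) + v := Lp.coeFn_add u.toL2 v.toL2

lemma coe_smul (c : ℝ) (u : X) : (c • u : X) =ᵐ[volume] c • (u : Plane → ℝ) :=
  Lp.coeFn_smul c u.toL2

/-- The weak gradient `∇u ∈ L²` of `u ∈ X`; it is unique up to null sets. -/
def grad (u : X) : Plane → Plane := Classical.choose u.memX.1.2

lemma grad_memLp (u : X) : MemLp u.grad 2 volume := (Classical.choose_spec u.memX.1.2).1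

lemma grad_hasWeakGradient (u : X) : HasWeakGradient u u.grad :=
  (Classical.choose_spec u.memX.1.2).2

lemma grad_add (u v : X) : (u + v).grad =ᵐ[volume] u.grad + v.grad :=
  (u + v).grad_hasWeakGradient.ae_unique
    (u.grad_hasWeakGradient.add v.grad_hasWeakGradient u.memLp v.memLp u.grad_memLp v.grad_memLp)
    (coe_add u v) (u + v).grad_memLp (u.grad_memLp.add v.grad_memLp)

lemma grad_smul (c : ℝ) (u : X) : (c • u).grad =ᵐ[volume] c • u.grad :=
  (c • u).grad_hasWeakGradient.ae_unique (u.grad_hasWeakGradient.const_smul c)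
    (coe_smul c u) (c • u).grad_memLp (u.grad_memLp.const_smul c)

lemma integrable_h1 (u v : X) :
    Integrable (fun x => ⟪u.grad x, v.grad x⟫_ℝ + u x * v x) volume := by
  refine Integrable.add ?_ (u.memLp.integrable_mul v.memLp)
  refine (u.grad_memLp.norm.integrable_mul v.grad_memLp.norm).mono'
    (u.grad_memLp.aestronglyMeasurable.inner v.grad_memLp.aestronglyMeasurable)
    (Eventually.of_forall fun x => ?_)
  simpa using abs_real_inner_le_norm (u.grad x) (v.grad x)

/-- The scalar product
`⟨u | v⟩_X = ∫ (∇u · ∇v + u v) dx + ∫ log (1 + |x|) u v dx`. -/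
def innerX (u v : X) : ℝ :=
  (∫ x, (⟪u.grad x, v.grad x⟫_ℝ + u x * v x)) + ∫ x, Real.log (1 + ‖x‖) * (u x * v x)

/-- `innerX` is a (positive definite) inner product on `X`. -/
@[reducible] def core : InnerProductSpace.Core ℝ X where
  inner := innerX
  conj_inner_symm u v := by
    simp only [innerX, conj_trivial]
    congr 1 <;> refine integral_congr_ae (Eventually.of_forall fun x => ?_)
    · simp only [real_inner_comm, mul_comm]
    · simp only [mul_comm (u x)]
  re_inner_nonneg u := by
    simp only [innerX, RCLike.re_to_real]
    refine add_nonneg (integral_nonneg fun x => ?_) (integral_nonneg fun x => ?_)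
    · exact add_nonneg real_inner_self_nonneg (mul_self_nonneg _)
    · exact mul_nonneg (log_weight_nonneg x) (mul_self_nonneg _)
  add_left u v w := by
    simp only [innerX]
    rw [add_add_add_comm, ← integral_add (integrable_h1 u w) (integrable_h1 v w),
      ← integral_add (integrable_log_mul u.memX w.memX) (integrable_log_mul v.memX w.memX)]
    congr 1 <;> refine integral_congr_ae ?_
    · filter_upwards [coe_add u v, grad_add u v] with x h1 h2
      simp only [h1, h2, Pi.add_apply, inner_add_left]
      ring
    · filter_upwards [coe_add u v] with x h1
      simp only [h1, Pi.add_apply]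
      ring
  smul_left u v c := by
    simp only [innerX, conj_trivial]
    rw [mul_add, ← integral_const_mul, ← integral_const_mul]
    congr 1 <;> refine integral_congr_ae ?_
    · filter_upwards [coe_smul c u, grad_smul c u] with x h1 h2
      simp only [h1, h2, Pi.smul_apply, real_inner_smul_left, smul_eq_mul]
      ring
    · filter_upwards [coe_smul c u] with x h1
      simp only [h1, Pi.smul_apply, smul_eq_mul]
      ring
  definite u hu := by
    have hu' : innerX u u = 0 := hu
    have h2 : 0 ≤ ∫ x, Real.log (1 + ‖x‖) * (u x * u x) :=
      integral_nonneg fun x => mul_nonneg (log_weight_nonneg x) (mul_self_nonneg _)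
    have hn : ∀ x, 0 ≤ ⟪u.grad x, u.grad x⟫_ℝ + u x * u x := fun x =>
      add_nonneg real_inner_self_nonneg (mul_self_nonneg _)
    have h1 : 0 ≤ ∫ x, (⟪u.grad x, u.grad x⟫_ℝ + u x * u x) := integral_nonneg hn
    have h0 : ∫ x, (⟪u.grad x, u.grad x⟫_ℝ + u x * u x) = 0 := by
      unfold innerX at hu'
      linarith
    have hz := (integral_eq_zero_iff_of_nonneg hn (integrable_h1 u u)).1 h0
    have hz' : u.toL2 = 0 := by
      refine (Lp.eq_zero_iff_ae_eq_zero).2 (hz.mono fun x hx => ?_)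
      simp only [Pi.zero_apply] at hx ⊢
      have h3 : 0 ≤ ⟪u.grad x, u.grad x⟫_ℝ := real_inner_self_nonneg
      exact mul_self_eq_zero.1 (le_antisymm (by linarith) (mul_self_nonneg _))
    exact Subtype.ext hz'

instance : NormedAddCommGroup X := core.toNormedAddCommGroup

instance : InnerProductSpace ℝ X := InnerProductSpace.ofCore core.toCore

/-- `‖u‖²_X = ∫ (|∇u|² + u²) dx + ∫ log (1 + |x|) u² dx`. -/
lemma norm_sq_eq (u : X) :
    ‖u‖ ^ 2 = (∫ x, (‖u.grad x‖ ^ 2 + u x ^ 2)) + ∫ x, Real.log (1 + ‖x‖) * u x ^ 2 := by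
  rw [← real_inner_self_eq_norm_sq]
  change innerX u u = _
  simp only [innerX, real_inner_self_eq_norm_sq, pow_two (u _)]

end X

/-- `I(u) = ½ ∫ (|∇u|² + u²) dx + (1/8π) ∬ log |x - y| u(x)² u(y)² dx dy`. -/
def energy (u : X) : ℝ :=
  1 / 2 * (∫ x, (‖u.grad x‖ ^ 2 + u x ^ 2)) +
    1 / (8 * Real.pi) * ∫ p : Plane × Plane, Real.log ‖p.1 - p.2‖ * u p.1 ^ 2 * u p.2 ^ 2

/-- `I''(u) : X → X*`, the second Fréchet derivative of the energy at `u`. -/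
def energyHessian (u : X) : X →L[ℝ] StrongDual ℝ X := fderiv ℝ (fderiv ℝ energy) u

/-- `B(f, g) = -(1/2π) ∬ log |x - y| f(x) g(y) dx dy`. -/
def logForm (f g : Plane → ℝ) : ℝ :=
  -(1 / (2 * Real.pi)) * ∫ p : Plane × Plane, Real.log ‖p.1 - p.2‖ * f p.1 * g p.2

/-- `w(x) = (1/2π) ∫ log (1 / |x - y|) u(y)² dy`, the logarithmic potential of `u²`. -/
def logPotential (u : X) (x : Plane) : ℝ :=
  1 / (2 * Real.pi) * ∫ y, Real.log (1 / ‖x - y‖) * u y ^ 2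

/-- `u` solves `-Δu + u = (1/2π) [log (1/|·|) ⋆ u²] u` in `ℝ²`, in the weak sense. -/
def IsWeakSolution (u : X) : Prop :=
  ∀ φ : Plane → ℝ, ContDiff ℝ ∞ φ → HasCompactSupport φ →
    ∫ x, (⟪u.grad x, gradient φ x⟫_ℝ + u x * φ x) = ∫ x, logPotential u x * u x * φ x

/-- The index `dim ker T - dim coker T` of a Fredholm operator. -/
def fredholmIndex {E F : Type*} [AddCommGroup E] [Module ℝ E] [TopologicalSpace E]
    [AddCommGroup F] [Module ℝ F] [TopologicalSpace F] (T : E →L[ℝ] F) : ℤ :=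
  (Module.finrank ℝ T.ker : ℤ) - (Module.finrank ℝ (F ⧸ T.range) : ℤ)

end LogChoquard

end

open MeasureTheory Set Filter
open scoped ContDiff InnerProductSpace

noncomputable section

open scoped Convolution ENNReal NNReal Topology

set_option maxSynthPendingDepth 3

namespace LogChoquard

/-! The interaction `∬ log |x - y| f g (x) h k (y)` is a bounded 4-linear form on `X`. Indeed `|log
|x - y||` is at most `log (1 + |x|) + log (1 + |y|)` plus a singular part supported in `|x - y| < 1`
(`enorm_log_le`). The weights are absorbed by the norm of `X`. The singular part is in `L²` and is
paired with `f g ∈ L²`, which comes from the embedding of `H¹(ℝ²)` in `L⁴`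
(`exists_lintegral_pow_four_le`). Hence `I` is a continuous polynomial of degree four, therefore
smooth, and its second derivative is read off from the symmetries of the form
(`IsQuarticForm.fderiv_fderiv_apply`).

In `I''(u)` the term with `u(y)² φ(x) ψ(x)` is not compact, because its kernel grows like `log |x|`.
Subtracting `log (1 + |x|)` leaves a kernel bounded by `log (1 + |y|) + 1` plus the singular part,
with no growth in `x` (`enorm_log_sub_le`). The subtracted term is `c²` times the weighted scalar
product and goes into `A`; since `u > 0` gives `c² > 0`, `A` is coercive. What remains, `K`, is
bounded by the `L²` norm of `φ` plus an arbitrarily small multiple of its norm in `X`. The embedding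
of `X` in `L²` is compact (`isCompactOperator_toL2L`): the weight prevents escape to infinity and
the gradient gives local compactness. So `K` is compact by `isCompactOperator_of_forall_le`.

Finally `A` is invertible by Lax–Milgram, and a symmetric operator `A + K` of this kind is Fredholm
with range identified with the orthogonal complement of its kernel, so kernel and cokernel have the
same dimension (`isFredholm_of_coercive_add_compact`). -/

/-! ### Compactness criterion and Fredholm theory of coercive plus compact operators -/

/-- A bounded operator that is dominated, up to arbitrarily small multiples of the norm, by compact
operators is compact. -/
theorem isCompactOperator_of_forall_le {V Y : Type*} [NormedAddCommGroup V] [NormedSpace ℝ V]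
    [NormedAddCommGroup Y] [NormedSpace ℝ Y] [CompleteSpace Y] (T : V →L[ℝ] Y)
    (h : ∀ ε : ℝ, 0 < ε → ∃ (Z : Type) (_ : NormedAddCommGroup Z) (_ : NormedSpace ℝ Z)
      (S : V →L[ℝ] Z), IsCompactOperator S ∧ ∀ x, ‖T x‖ ≤ ‖S x‖ + ε * ‖x‖) :
    IsCompactOperator T := by
  refine (isCompactOperator_iff_exists_mem_nhds_image_subset_compact _).2
    ⟨Metric.ball 0 1, Metric.ball_mem_nhds _ one_pos, closure (T '' Metric.ball 0 1), ?_,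
      subset_closure⟩
  refine TotallyBounded.isCompact_of_isClosed ?_ isClosed_closure
  refine TotallyBounded.closure ?_
  rw [Metric.totallyBounded_iff]
  intro δ hδ
  obtain ⟨Z, _, _, S, hS, hST⟩ := h (δ / 8) (by positivity)
  obtain ⟨C, hC, hSC⟩ := hS.image_ball_subset_compact 1
  have htb : TotallyBounded (S '' Metric.ball 0 1) := hC.totallyBounded.subset hSC
  -- Two points of the unit ball differ by less than `2` in norm, so images under `S` at distance `<
  -- δ / 4` give images under `T` at distance `< δ / 4 + 2 * (δ / 8) < δ`.
  obtain ⟨t, ht, htf, hcov⟩ := totallyBounded_iff_subset.1 htb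
    {p : Z × Z | dist p.1 p.2 < δ / 4} (Metric.dist_mem_uniformity (by positivity))
  obtain ⟨t', ht', rfl⟩ := subset_image_iff.1 ht
  obtain ⟨s, hs, hsf, hst⟩ : ∃ s ⊆ t', s.Finite ∧ S '' s = S '' t' := by
    obtain ⟨s, hs, he⟩ := exists_subset_bijOn t' S
    exact ⟨s, hs, (Set.finite_image_iff he.injOn).1 (he.image_eq ▸ htf), he.image_eq⟩
  refine ⟨T '' s, hsf.image _, ?_⟩
  rintro _ ⟨x, hx, rfl⟩
  have := hcov (mem_image_of_mem S hx)
  rw [← hst] at this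
  simp only [mem_iUnion, exists_prop, mem_image, exists_exists_and_eq_and] at this ⊢
  obtain ⟨y, hy, hxy⟩ := this
  have hy1 := ht' (hs hy)
  refine ⟨y, hy, ?_⟩
  rw [mem_ball_zero_iff] at hx hy1
  simp only [mem_ofPred_eq, Metric.mem_ball, dist_eq_norm, ← map_sub] at hxy ⊢
  have h1 := hST (x - y)
  have h2 : δ / 8 * ‖x - y‖ ≤ δ / 8 * 2 :=
    mul_le_mul_of_nonneg_left (by linarith [norm_sub_le x y]) (by positivity)
  linarith

/-- Lax–Milgram, followed by the Riesz isomorphism. -/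
theorem _root_.IsCoercive.isInvertible {V : Type*} [NormedAddCommGroup V] [InnerProductSpace ℝ V]
    [CompleteSpace V] {A : V →L[ℝ] StrongDual ℝ V} (hA : IsCoercive A) : A.IsInvertible := by
  refine ⟨hA.continuousLinearEquivOfBilin.trans
    (InnerProductSpace.toDual ℝ V).toContinuousLinearEquiv, ?_⟩
  ext x y
  simp

/-- A symmetric compact perturbation of a coercive operator is Fredholm of index zero. -/
theorem isFredholm_of_coercive_add_compact {V : Type*} [NormedAddCommGroup V]
    [InnerProductSpace ℝ V] [CompleteSpace V] {S A K : V →L[ℝ] StrongDual ℝ V} (hS : S = A + K)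
    (hA : IsCoercive A) (hK : IsCompactOperator K) (hsymm : ∀ x y, S x y = S y x) :
    S.IsFredholm ∧ fredholmIndex S = 0 := by
  obtain ⟨e, he⟩ := hA.isInvertible
  -- On `ker S` the identity equals `-A⁻¹ K`, which is compact.
  have hfin : FiniteDimensional ℝ S.ker := by
    have hc : IsCompactOperator (fun x : S.ker => (-(e.symm (K x)) : V)) :=
      ((hK.clm_comp (e.symm : StrongDual ℝ V →L[ℝ] V)).neg).comp_clm S.ker.subtypeL
    have hid : (fun x : S.ker => (-(e.symm (K x)) : V)) = fun x : S.ker => (x : V) := by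
      funext x
      have hx : e x + K x = 0 := by
        have : S x = 0 := x.2
        rwa [show S (x : V) = e x + K x by simp [hS, ← he]] at this
      have : K x = -(e x) := by rw [eq_neg_iff_add_eq_zero, add_comm]; exact hx
      simp [this]
    rw [hid] at hc
    have := hc.codRestrict (V := S.ker) (fun x => x.2) S.isClosed_ker
    exact FiniteDimensional.of_isCompactOperator_id (𝕜 := ℝ) this
  let P : V →L[ℝ] V := S.ker.starProjection
  let J : V ≃L[ℝ] StrongDual ℝ V := (InnerProductSpace.toDual ℝ V).toContinuousLinearEquiv
  have hJ : ∀ x y : V, J x y = ⟪x, y⟫_ℝ := fun x y => by simp [J]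
  have hPS : ∀ x y, S x (P y) = 0 := fun x y => by
    rw [hsymm]
    have : S (P y) = 0 := (S.ker.starProjection_apply_mem y)
    simp [this]
  -- Testing with `P x` kills `S x` by symmetry, so `P x = 0`; then `x` lies in `ker S` and equals
  -- its own projection.
  have hinj : ∀ x, S x + J (P x) = 0 → x = 0 := by
    intro x hx
    have h1 : S x (P x) + ⟪P x, P x⟫_ℝ = 0 := by
      have := congr($hx (P x))
      simpa [hJ] using this
    rw [hPS, zero_add, inner_self_eq_zero] at h1
    have h2 : S x = 0 := by simpa [h1] using hx
    rw [← h1]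
    exact (Submodule.starProjection_eq_self_iff.2 h2).symm
  have hPc : IsCompactOperator P := by
    have h := (isCompactOperator_id_iff_finiteDimensional (𝕜 := ℝ) (E := S.ker)).2 hfin
    exact (h.clm_comp S.ker.subtypeL).comp_clm S.ker.orthogonalProjectionOnto
  -- `S + J P = A (1 + Q)` with `Q` compact, so by the Fredholm alternative injectivity makes `S + J
  -- P` an isomorphism. Its inverse inverts `S` up to finite rank.
  let Q : V →L[ℝ] V := (e.symm : StrongDual ℝ V →L[ℝ] V) ∘L (K + (J : V →L[ℝ] StrongDual ℝ V) ∘L P)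
  have hQ : IsCompactOperator Q :=
    (hK.add (hPc.clm_comp (J : V →L[ℝ] StrongDual ℝ V))).clm_comp (e.symm : StrongDual ℝ V →L[ℝ] V)
  have heQ : ∀ x, e (x + Q x) = S x + J (P x) := fun x => by
    simp [Q, hS, ← he, add_assoc]
  have hbij : Function.Bijective (1 + Q : V →L[ℝ] V) := by
    rw [← ContinuousLinearMap.isUnit_iff_bijective]
    rcases hQ.hasEigenvalue_or_mem_resolventSet (μ := (-1 : ℝ)) (by norm_num) with h | h
    · exfalso
      obtain ⟨x, hx⟩ := h.exists_hasEigenvector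
      have h1 : Q x = -x := by simpa using hx.apply_eq_smul
      refine hx.2 (hinj x ?_)
      rw [← heQ, h1]
      simp
    · rw [spectrum.mem_resolventSet_iff] at h
      simpa [neg_add_eq_sub, add_comm] using h.neg
  let F : V ≃L[ℝ] StrongDual ℝ V :=
    (ContinuousLinearEquiv.ofBijective (1 + Q) (LinearMap.ker_eq_bot.2 hbij.1)
      (LinearMap.range_eq_top.2 hbij.2)).trans e
  have hF : ∀ x, F x = S x + J (P x) := fun x => by
    rw [← heQ]; simp [F]
  have hPfin : (-(P : V →ₗ[ℝ] V)).HasFiniteRange := by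
    refine (Module.Finite.iff_fg (N := S.ker)).1 hfin |>.of_le ?_
    rintro _ ⟨x, rfl⟩
    exact S.ker.neg_mem (S.ker.starProjection_apply_mem x)
  refine ⟨ContinuousLinearMap.IsFredholm.of_isQuasiInverse
    (v := (F.symm : StrongDual ℝ V →L[ℝ] V)) ⟨?_, ?_⟩, ?_⟩
  · refine LinearMap.FiniteRangeSetoid.equiv_iff_hasFiniteRange.2 ?_
    have key : (F.symm : StrongDual ℝ V →ₗ[ℝ] V) ∘ₗ (S : V →ₗ[ℝ] StrongDual ℝ V) - LinearMap.id =
        ((F.symm : StrongDual ℝ V →ₗ[ℝ] V) ∘ₗ (J : V →ₗ[ℝ] StrongDual ℝ V)) ∘ₗ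
          (-(P : V →ₗ[ℝ] V)) := by
      ext x
      have : S x = F x - J (P x) := by rw [hF]; abel
      simp [this]
    exact key ▸ hPfin.comp_left _
  · refine LinearMap.FiniteRangeSetoid.equiv_iff_hasFiniteRange.2 ?_
    have key : (S : V →ₗ[ℝ] StrongDual ℝ V) ∘ₗ (F.symm : StrongDual ℝ V →ₗ[ℝ] V) - LinearMap.id =
        (J : V →ₗ[ℝ] StrongDual ℝ V) ∘ₗ (-(P : V →ₗ[ℝ] V)) ∘ₗ
          (F.symm : StrongDual ℝ V →ₗ[ℝ] V) := by
      ext1 f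
      have : S (F.symm f) = f - J (P (F.symm f)) := by
        rw [eq_sub_iff_add_eq, ← hF, F.apply_symm_apply]
      simp [this]
    exact key ▸ (hPfin.comp_right _).comp_left _
  -- By symmetry every `S x` annihilates `ker S`. Conversely, for `y ⟂ ker S` the solution of `S x +
  -- J (P x) = J y`, tested with `P x`, has `P x = 0`.
  have hrange : S.range = S.kerᗮ.map (J.toLinearEquiv : V →ₗ[ℝ] StrongDual ℝ V) := by
    ext f
    simp only [LinearMap.mem_range, Submodule.mem_map]
    constructor
    · rintro ⟨x, rfl⟩
      refine ⟨J.symm (S x), ?_, by simp⟩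
      rw [Submodule.mem_orthogonal']
      intro y hy
      rw [← hJ, J.apply_symm_apply]
      change S x y = 0
      rw [hsymm, show S y = 0 from hy]
      simp
    · rintro ⟨y, hy, rfl⟩
      obtain ⟨x, hx⟩ := F.surjective (J y)
      refine ⟨x, ?_⟩
      have h0 : P x = 0 := by
        have := congr($((hF x).symm.trans hx) (P x))
        simp only [_root_.add_apply, hPS, hJ, zero_add] at this
        rw [Submodule.inner_left_of_mem_orthogonal (S.ker.starProjection_apply_mem x) hy] at this
        simpa using this
      simpa [hF, h0] using hx
  have e1 : (StrongDual ℝ V ⧸ S.range) ≃ₗ[ℝ] (V ⧸ S.kerᗮ) :=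
    (Submodule.Quotient.equiv _ _ J.toLinearEquiv hrange.symm).symm
  have e2 : (V ⧸ S.kerᗮ) ≃ₗ[ℝ] S.ker :=
    Submodule.quotientEquivOfIsCompl _ _ (Submodule.isCompl_orthogonal (K := S.ker)).symm
  rw [fredholmIndex, (e1.trans e2).finrank_eq, sub_self]

/-! ### Mollification and translation of functions with a weak gradient -/

/-- The Cauchy–Schwarz inequality for the Lebesgue integral. -/
theorem lintegral_mul_sq_le {α : Type*} [MeasurableSpace α] (μ : Measure α) {f g : α → ℝ≥0∞}
    (hf : AEMeasurable f μ) (hg : AEMeasurable g μ) :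
    (∫⁻ a, f a * g a ∂μ) ^ 2 ≤ (∫⁻ a, f a ^ 2 ∂μ) * ∫⁻ a, g a ^ 2 ∂μ := by
  have h := ENNReal.lintegral_mul_le_Lp_mul_Lq μ Real.HolderConjugate.two_two hf hg
  simp only [Pi.mul_apply, ENNReal.rpow_two] at h
  calc (∫⁻ a, f a * g a ∂μ) ^ 2
      ≤ ((∫⁻ a, f a ^ 2 ∂μ) ^ (1 / (2 : ℝ)) * (∫⁻ a, g a ^ 2 ∂μ) ^ (1 / (2 : ℝ))) ^ 2 := by gcongr
    _ = _ := by
      rw [mul_pow, ← ENNReal.rpow_two, ← ENNReal.rpow_two, ← ENNReal.rpow_mul, ← ENNReal.rpow_mul]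
      norm_num

/-- The square of an average is at most the average of the squares. -/
theorem lintegral_sq_le {α : Type*} [MeasurableSpace α] (μ : Measure α) {f w : α → ℝ≥0∞}
    (hf : AEMeasurable f μ) (hw : AEMeasurable w μ) :
    (∫⁻ a, w a * f a ∂μ) ^ 2 ≤ (∫⁻ a, w a ∂μ) * ∫⁻ a, w a * f a ^ 2 ∂μ := by
  have hsq : ∀ a, (w a ^ (1 / 2 : ℝ)) ^ 2 = w a := fun a => by
    rw [← ENNReal.rpow_two, ← ENNReal.rpow_mul]; norm_num
  have h := lintegral_mul_sq_le μ (hw.pow_const (1 / 2 : ℝ)) ((hw.pow_const (1 / 2 : ℝ)).mul hf)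
  simp only [Pi.mul_apply, mul_pow, hsq] at h
  refine le_trans (le_of_eq ?_) h
  congr 1
  refine lintegral_congr fun a => ?_
  rw [← mul_assoc, ← sq, hsq]

theorem aemeasurable_comp_sub {β : Type*} [MeasurableSpace β] {f : Plane → β}
    (hf : AEMeasurable f) : AEMeasurable (fun p : Plane × Plane => f (p.1 - p.2)) :=
  hf.comp_quasiMeasurePreserving (quasiMeasurePreserving_sub volume volume)

/-- Averaging against a probability density does not increase the `L²` norm. -/
theorem lintegral_convolution_sq_le {E : Type*} [NormedAddCommGroup E] [NormedSpace ℝ E]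
    {ρ : Plane → ℝ} {f : Plane → E} (hρ : AEMeasurable ρ)
    (hρ1 : ∫⁻ x, ‖ρ x‖ₑ = 1) (hf : AEStronglyMeasurable f) :
    ∫⁻ x, ‖(ρ ⋆[ContinuousLinearMap.lsmul ℝ ℝ, volume] f) x‖ₑ ^ 2 ≤ ∫⁻ x, ‖f x‖ₑ ^ 2 := by
  calc ∫⁻ x, ‖(ρ ⋆[ContinuousLinearMap.lsmul ℝ ℝ, volume] f) x‖ₑ ^ 2
      ≤ ∫⁻ x, ∫⁻ t, ‖ρ t‖ₑ * ‖f (x - t)‖ₑ ^ 2 := by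
        refine lintegral_mono fun x => ?_
        have h1 : ‖(ρ ⋆[ContinuousLinearMap.lsmul ℝ ℝ, volume] f) x‖ₑ
            ≤ ∫⁻ t, ‖ρ t‖ₑ * ‖f (x - t)‖ₑ := by
          refine (enorm_integral_le_lintegral_enorm _).trans (le_of_eq ?_)
          simp [enorm_smul]
        refine (pow_le_pow_left' h1 2).trans ?_
        refine (lintegral_sq_le volume ?_ hρ.enorm).trans ?_
        · exact (hf.comp_quasiMeasurePreserving
            (quasiMeasurePreserving_sub_left_of_right_invariant volume x)).enorm
        · rw [hρ1, one_mul]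
    _ = ∫⁻ t, ∫⁻ x, ‖ρ t‖ₑ * ‖f (x - t)‖ₑ ^ 2 :=
by
        have h1 : AEMeasurable (fun z : Plane × Plane => ‖ρ z.2‖ₑ) := hρ.enorm.comp_snd
        have h2 := (aemeasurable_comp_sub (f := fun x => ‖f x‖ₑ) hf.enorm).pow_const 2
        exact lintegral_lintegral_swap (h1.mul h2)
    _ = ∫⁻ t, ‖ρ t‖ₑ * ∫⁻ x, ‖f x‖ₑ ^ 2 := by
        refine lintegral_congr fun t => ?_
        rw [lintegral_const_mul'' _ ?_, lintegral_sub_right_eq_self (fun x => ‖f x‖ₑ ^ 2)]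
        exact ((hf.comp_quasiMeasurePreserving
          (measurePreserving_sub_right volume t).quasiMeasurePreserving).enorm).pow_const 2
    _ = ∫⁻ x, ‖f x‖ₑ ^ 2 := by
        rw [lintegral_mul_const'' _ hρ.enorm, hρ1, one_mul]

/-- Mollification commutes with weak differentiation. -/
theorem HasWeakGradient.fderiv_convolution {f : Plane → ℝ} {G : Plane → Plane}
    (hG : HasWeakGradient f G) (hf : MemLp f 2) (hG2 : MemLp G 2) {ρ : Plane → ℝ}
    (hρ : ContDiff ℝ ∞ ρ) (hc : HasCompactSupport ρ) (x : Plane) :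
    fderiv ℝ (ρ ⋆[ContinuousLinearMap.lsmul ℝ ℝ, volume] f) x =
      InnerProductSpace.toDual ℝ Plane ((ρ ⋆[ContinuousLinearMap.lsmul ℝ ℝ, volume] G) x) := by
  have hfl : LocallyIntegrable f := hf.locallyIntegrable (by norm_num)
  have hρ' : Continuous (fderiv ℝ ρ) := hρ.continuous_fderiv (by simp)
  rw [(hc.hasFDerivAt_convolution_left (ContinuousLinearMap.lsmul ℝ ℝ) (hρ.of_le (by simp))
    hfl x).fderiv]
  -- The test function is the reflected mollifier centred at `x`; the sign from the reflection
  -- cancels the one in the definition of the weak gradient.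
  let ψ : Plane → ℝ := fun y => ρ (x - y)
  have hψ : ContDiff ℝ ∞ ψ := hρ.comp (contDiff_const.sub contDiff_id)
  have hψc : HasCompactSupport ψ := hc.comp_homeomorph (Homeomorph.subLeft x)
  have hψd : ∀ y, fderiv ℝ ψ y = -(fderiv ℝ ρ (x - y)) := fun y => by
    have h1 : HasFDerivAt ρ (fderiv ℝ ρ (x - y)) (x - y) :=
      (hρ.differentiable (by simp) _).hasFDerivAt
    have h2 : HasFDerivAt (fun y => x - y) (-(ContinuousLinearMap.id ℝ Plane)) y :=
      (hasFDerivAt_id y).const_sub x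
    have h3 : HasFDerivAt ψ _ y := h1.comp y h2
    simpa using h3.fderiv
  have key := hG ψ hψ hψc
  have hint := integrable_smul_gradient hf hψ hψc
  have hintG := integrable_smul_field hG2 hψ hψc
  rw [convolution_eq_swap, convolution_eq_swap]
  ext v
  rw [InnerProductSpace.toDual_apply_apply, real_inner_comm]
  simp only [ContinuousLinearMap.lsmul_apply]
  have e1 : ⟪v, ∫ y, ψ y • G y⟫_ℝ = -∫ y, f y * fderiv ℝ ψ y v := by
    rw [← neg_eq_iff_eq_neg, ← inner_neg_right, ← key, ← integral_inner hint]
    refine integral_congr_ae (Eventually.of_forall fun y => ?_)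
    simp only [inner_smul_right]
    rw [real_inner_comm, gradient, InnerProductSpace.toDual_symm_apply]
  change _ = ⟪v, ∫ y, ψ y • G y⟫_ℝ
  rw [e1, ← integral_neg, ContinuousLinearMap.integral_apply]
  · refine integral_congr_ae (Eventually.of_forall fun y => ?_)
    simp [hψd, ContinuousLinearMap.precompL_apply, mul_comm]
  · have := (hc.fderiv (𝕜 := ℝ)).convolutionExists_left
      (ContinuousLinearMap.precompL Plane (ContinuousLinearMap.lsmul ℝ ℝ)) hρ' hfl x
    exact this.integrable_swap

/-- Functions with a weak gradient in `L²` are limits of smooth ones, with control of the norms. -/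
theorem HasWeakGradient.exists_smooth_approx {f : Plane → ℝ} {G : Plane → Plane}
    (hG : HasWeakGradient f G) (hf : MemLp f 2) (hG2 : MemLp G 2) :
    ∃ g : ℕ → Plane → ℝ, (∀ n, ContDiff ℝ ∞ (g n)) ∧
      (∀ᵐ x, Tendsto (fun n => g n x) atTop (𝓝 (f x))) ∧
      (∀ n, ∫⁻ x, ‖g n x‖ₑ ^ 2 ≤ ∫⁻ x, ‖f x‖ₑ ^ 2) ∧
      ∀ n, ∫⁻ x, ‖fderiv ℝ (g n) x‖ₑ ^ 2 ≤ ∫⁻ x, ‖G x‖ₑ ^ 2 := by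
  have hfl : LocallyIntegrable f := hf.locallyIntegrable (by norm_num)
  -- The outer radius is twice the inner one: a bounded ratio of radii is what yields convergence
  -- almost everywhere (Lebesgue points).
  let φ : ℕ → ContDiffBump (0 : Plane) := fun n =>
    ⟨1 / ((n : ℝ) + 1), 2 * (1 / ((n : ℝ) + 1)), by positivity, by
      have : (0 : ℝ) < 1 / ((n : ℝ) + 1) := by positivity
      linarith⟩
  have h1 : ∀ n, ∫⁻ x, ‖(φ n).normed volume x‖ₑ = 1 := fun n => by
    have := ofReal_integral_eq_lintegral_ofReal ((φ n).integrable_normed (μ := volume))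
      (Eventually.of_forall (φ n).nonneg_normed)
    rw [(φ n).integral_normed, ENNReal.ofReal_one] at this
    rw [this]
    exact lintegral_congr fun x => Real.enorm_of_nonneg ((φ n).nonneg_normed x)
  have hm : ∀ n, AEMeasurable ((φ n).normed volume) := fun n =>
    ((φ n).continuous_normed (μ := volume)).aemeasurable
  refine ⟨fun n => (φ n).normed volume ⋆[ContinuousLinearMap.lsmul ℝ ℝ, volume] f,
    fun n => (φ n).hasCompactSupport_normed.contDiff_convolution_left _ (φ n).contDiff_normed hfl,
    ?_, fun n => lintegral_convolution_sq_le (hm n) (h1 n) hf.1, fun n => ?_⟩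
  · refine ContDiffBump.ae_convolution_tendsto_right_of_locallyIntegrable (K := 2) ?_
      (Eventually.of_forall fun n => le_rfl) hfl
    have := (tendsto_one_div_add_atTop_nhds_zero_nat (𝕜 := ℝ)).const_mul 2
    rwa [mul_zero] at this
  · refine le_trans (le_of_eq ?_) (lintegral_convolution_sq_le (hm n) (h1 n) hG2.1)
    refine lintegral_congr fun x => ?_
    rw [hG.fderiv_convolution hf hG2 (φ n).contDiff_normed (φ n).hasCompactSupport_normed]
    simp [enorm_eq_nnnorm]

/-- The increment is the integral of the derivative along the segment from `x` to `x + h`.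
Cauchy–Schwarz on `[0, 1]`, Tonelli and translation invariance finish. -/
theorem lintegral_translate_sub_sq_le_of_contDiff {g : Plane → ℝ} (hg : ContDiff ℝ 1 g)
    (h : Plane) :
    ∫⁻ x, ‖g (x + h) - g x‖ₑ ^ 2 ≤ ‖h‖ₑ ^ 2 * ∫⁻ x, ‖fderiv ℝ g x‖ₑ ^ 2 := by
  have hc : Continuous (fderiv ℝ g) := hg.continuous_fderiv (by simp)
  have hpt : ∀ x, ‖g (x + h) - g x‖ₑ ^ 2 ≤
      ‖h‖ₑ ^ 2 * ∫⁻ t in Ioc (0 : ℝ) 1, ‖fderiv ℝ g (x + t • h)‖ₑ ^ 2 := fun x => by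
    have hcx : Continuous fun t : ℝ => fderiv ℝ g (x + t • h) := by fun_prop
    have hd : ∀ t ∈ uIcc (0 : ℝ) 1,
        HasDerivAt (fun t : ℝ => g (x + t • h)) (fderiv ℝ g (x + t • h) h) t := fun t _ => by
      have h1 : HasFDerivAt g (fderiv ℝ g (x + t • h)) (x + t • h) :=
        (hg.differentiable (by simp) _).hasFDerivAt
      have h2 : HasDerivAt (fun t : ℝ => x + t • h) h t := by
        simpa using ((hasDerivAt_id t).smul_const h).const_add x
      exact h1.comp_hasDerivAt t h2
    have := intervalIntegral.integral_eq_sub_of_hasDerivAt hd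
      ((hcx.clm_apply continuous_const).intervalIntegrable 0 1)
    simp only [one_smul, zero_smul, add_zero] at this
    rw [← this, intervalIntegral.integral_of_le zero_le_one]
    have hb : ‖∫ t in Ioc (0 : ℝ) 1, fderiv ℝ g (x + t • h) h‖ₑ ≤
        ∫⁻ t in Ioc (0 : ℝ) 1, ‖h‖ₑ * ‖fderiv ℝ g (x + t • h)‖ₑ := by
      refine (enorm_integral_le_lintegral_enorm _).trans (lintegral_mono fun t => ?_)
      rw [mul_comm]
      exact ContinuousLinearMap.le_opENorm _ _
    refine (pow_le_pow_left' hb 2).trans ?_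
    rw [lintegral_const_mul _ hcx.measurable.enorm, mul_pow]
    gcongr
    have := lintegral_sq_le (volume.restrict (Ioc (0 : ℝ) 1)) (w := fun _ => 1)
      hcx.measurable.enorm.aemeasurable aemeasurable_const
    simpa using this
  calc ∫⁻ x, ‖g (x + h) - g x‖ₑ ^ 2
      ≤ ∫⁻ x, ‖h‖ₑ ^ 2 * ∫⁻ t in Ioc (0 : ℝ) 1, ‖fderiv ℝ g (x + t • h)‖ₑ ^ 2 :=
        lintegral_mono hpt
    _ = ‖h‖ₑ ^ 2 * ∫⁻ x, ∫⁻ t in Ioc (0 : ℝ) 1, ‖fderiv ℝ g (x + t • h)‖ₑ ^ 2 :=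
        lintegral_const_mul' _ _ (by simp)
    _ = ‖h‖ₑ ^ 2 * ∫⁻ t in Ioc (0 : ℝ) 1, ∫⁻ x, ‖fderiv ℝ g (x + t • h)‖ₑ ^ 2 := by
        congr 1
        refine lintegral_lintegral_swap ?_
        have : Continuous fun p : Plane × ℝ => fderiv ℝ g (p.1 + p.2 • h) := by fun_prop
        exact (this.measurable.enorm.pow_const 2).aemeasurable
    _ = ‖h‖ₑ ^ 2 * ∫⁻ x, ‖fderiv ℝ g x‖ₑ ^ 2 := by
        congr 1
        simp_rw [lintegral_add_right_eq_self (fun x => ‖fderiv ℝ g x‖ₑ ^ 2)]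
        simp

/-- Translations are Lipschitz in `L²` on functions with a square integrable gradient. -/
theorem HasWeakGradient.lintegral_translate_sub_sq_le {f : Plane → ℝ} {G : Plane → Plane}
    (hG : HasWeakGradient f G) (hf : MemLp f 2) (hG2 : MemLp G 2) (h : Plane) :
    ∫⁻ x, ‖f (x + h) - f x‖ₑ ^ 2 ≤ ‖h‖ₑ ^ 2 * ∫⁻ x, ‖G x‖ₑ ^ 2 := by
  obtain ⟨g, hg, hlim, -, hgG⟩ := hG.exists_smooth_approx hf hG2
  have hlim' : ∀ᵐ x, Tendsto (fun n => g n (x + h)) atTop (𝓝 (f (x + h))) :=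
    (measurePreserving_add_right volume h).quasiMeasurePreserving.ae hlim
  -- Fatou's lemma carries the bound from the smooth approximations to `f`.
  calc ∫⁻ x, ‖f (x + h) - f x‖ₑ ^ 2
      = ∫⁻ x, liminf (fun n => ‖g n (x + h) - g n x‖ₑ ^ 2) atTop := by
        refine lintegral_congr_ae ?_
        filter_upwards [hlim, hlim'] with x h1 h2
        exact ((ENNReal.continuous_pow 2).tendsto _ |>.comp (h2.sub h1).enorm).liminf_eq.symm
    _ ≤ liminf (fun n => ∫⁻ x, ‖g n (x + h) - g n x‖ₑ ^ 2) atTop := by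
        refine lintegral_liminf_le fun n => ?_
        have := (hg n).continuous
        exact (by fun_prop : Continuous fun x => g n (x + h) - g n x).measurable.enorm.pow_const 2
    _ ≤ ‖h‖ₑ ^ 2 * ∫⁻ x, ‖G x‖ₑ ^ 2 := by
        refine liminf_le_of_le (by isBoundedDefault) fun b hb => ?_
        obtain ⟨n, hn⟩ := hb.exists
        refine hn.trans ((lintegral_translate_sub_sq_le_of_contDiff
          ((hg n).of_le (by simp)) h).trans ?_)
        exact mul_le_mul_right (hgG n) _

/-! ### The embedding of `H¹(ℝ²)` in `L⁴(ℝ²)` -/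

/-- Ladyzhenskaya's inequality. -/
theorem exists_lintegral_pow_four_le_of_hasCompactSupport :
    ∃ C : ℝ≥0, ∀ g : Plane → ℝ, ContDiff ℝ 1 g → HasCompactSupport g →
      ∫⁻ x, ‖g x‖ₑ ^ 4 ≤ C * ((∫⁻ x, ‖g x‖ₑ ^ 2) * ∫⁻ x, ‖fderiv ℝ g x‖ₑ ^ 2) := by
  refine ⟨lintegralPowLePowLIntegralFDerivConst (volume : Measure Plane) 2 * 4,
    fun g hg hc => ?_⟩
  have hp : Real.HolderConjugate (Module.finrank ℝ Plane : ℝ) 2 := by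
    simpa using Real.HolderConjugate.two_two
  -- The Gagliardo–Nirenberg–Sobolev inequality from `W^{1,1}` to `L²` in the plane is applied to
  -- `g²`, whose gradient has norm `2 |g| |∇g|`; the factor `4` is the square of this `2`.
  have hg2 : ContDiff ℝ 1 (fun x => g x ^ 2) := hg.pow 2
  have hc2 : HasCompactSupport (fun x => g x ^ 2) :=
    hc.comp_left (g := fun y : ℝ => y ^ 2) (by simp)
  have h := lintegral_pow_le_pow_lintegral_fderiv volume hg2 hc2 hp
  have hfd : ∀ x, ‖fderiv ℝ (fun x => g x ^ 2) x‖ₑ = 2 * (‖g x‖ₑ * ‖fderiv ℝ g x‖ₑ) := fun x => by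
    have := ((hg.differentiable (by simp) x).hasFDerivAt.pow 2).fderiv
    rw [this]
    have h2 : ‖(2 : ℝ)‖ₑ = 2 := by rw [Real.enorm_of_nonneg zero_le_two]; simp
    simp [enorm_smul, mul_assoc, enorm_mul, h2]
  simp only [hfd, ENNReal.rpow_two, enorm_pow, ← pow_mul] at h
  refine h.trans ?_
  have hm := hg.continuous.measurable.enorm
  have hm' := (hg.continuous_fderiv (by simp)).measurable.enorm
  rw [lintegral_const_mul' _ _ (by simp), mul_pow]
  push_cast
  rw [mul_assoc]
  gcongr
  · norm_num
  · exact lintegral_mul_sq_le volume hm.aemeasurable hm'.aemeasurable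

theorem ennreal_add_sq_le (a b : ℝ≥0∞) : (a + b) ^ 2 ≤ 2 * (a ^ 2 + b ^ 2) := by
  have := ENNReal.rpow_add_le_mul_rpow_add_rpow a b (p := 2) (by norm_num)
  norm_num at this
  exact this

/-- Dilating a single bump by `n + 1 ≥ 1` only decreases its derivative, so one Lipschitz bound
serves all `n`. The cutoffs remove the compact support assumption in Ladyzhenskaya's inequality. -/
theorem exists_cutoff : ∃ (L : ℝ≥0) (χ : ℕ → Plane → ℝ), (∀ n, ContDiff ℝ 1 (χ n)) ∧
    (∀ n, HasCompactSupport (χ n)) ∧ (∀ n x, ‖χ n x‖ₑ ≤ 1) ∧ (∀ n x, ‖fderiv ℝ (χ n) x‖ₑ ≤ L) ∧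
    ∀ x, ∀ᶠ n in atTop, χ n x = 1 := by
  let φ : ContDiffBump (0 : Plane) := ⟨1, 2, one_pos, one_lt_two⟩
  have hφ : ContDiff ℝ 1 φ := φ.contDiff
  obtain ⟨L, hL⟩ := (φ.hasCompactSupport.fderiv (𝕜 := ℝ)).exists_bound_of_continuous
    (hφ.continuous_fderiv (by simp))
  have hr : ∀ n : ℕ, ((n : ℝ) + 1)⁻¹ ≠ 0 := fun n => by positivity
  refine ⟨L.toNNReal, fun n x => φ (((n : ℝ) + 1)⁻¹ • x), fun n => by fun_prop, fun n => ?_,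
    fun n x => ?_, fun n x => ?_, fun x => ?_⟩
  · exact φ.hasCompactSupport.comp_homeomorph (Homeomorph.smulOfNeZero _ (hr n))
  · rw [Real.enorm_of_nonneg φ.nonneg, ← ENNReal.ofReal_one]
    exact ENNReal.ofReal_le_ofReal φ.le_one
  · have h1 : HasFDerivAt φ (fderiv ℝ φ (((n : ℝ) + 1)⁻¹ • x)) (((n : ℝ) + 1)⁻¹ • x) :=
      (hφ.differentiable (by simp) _).hasFDerivAt
    have h2 : HasFDerivAt (fun x : Plane => φ (((n : ℝ) + 1)⁻¹ • x)) _ x :=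
      h1.comp x ((hasFDerivAt_id x).const_smul (((n : ℝ) + 1)⁻¹))
    rw [h2.fderiv, ← ofReal_norm]
    refine ENNReal.ofReal_le_ofReal ?_
    rw [ContinuousLinearMap.comp_smul, norm_smul, ContinuousLinearMap.comp_id, norm_inv]
    refine (mul_le_of_le_one_left (norm_nonneg _) (inv_le_one_of_one_le₀ ?_)).trans (hL _)
    rw [Real.norm_of_nonneg (by positivity)]
    simp
  · obtain ⟨N, hN⟩ := exists_nat_ge ‖x‖
    filter_upwards [eventually_ge_atTop N] with n hn
    refine φ.one_of_mem_closedBall ?_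
    rw [mem_closedBall_zero_iff, norm_smul, norm_inv, Real.norm_of_nonneg (by positivity)]
    change _ ≤ (1 : ℝ)
    rw [inv_mul_le_one₀ (by positivity)]
    have : (N : ℝ) ≤ n := by exact_mod_cast hn
    linarith

/-- The embedding of `H¹(ℝ²)` in `L⁴(ℝ²)`. -/
theorem exists_lintegral_pow_four_le :
    ∃ C : ℝ≥0, ∀ (f : Plane → ℝ) (G : Plane → Plane), HasWeakGradient f G → MemLp f 2 →
      MemLp G 2 → ∫⁻ x, ‖f x‖ₑ ^ 4 ≤
        C * ((∫⁻ x, ‖f x‖ₑ ^ 2) * ((∫⁻ x, ‖f x‖ₑ ^ 2) + ∫⁻ x, ‖G x‖ₑ ^ 2)) := by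
  obtain ⟨C, hC⟩ := exists_lintegral_pow_four_le_of_hasCompactSupport
  obtain ⟨L, χ, hχ, hχc, hχ1, hχL, hχlim⟩ := exists_cutoff
  refine ⟨C * (2 * (L ^ 2 + 1)), fun f G hG hf hG2 => ?_⟩
  obtain ⟨g, hg, hlim, hgf, hgG⟩ := hG.exists_smooth_approx hf hG2
  have hg1 : ∀ n, ContDiff ℝ 1 (g n) := fun n => (hg n).of_le (by simp)
  -- The product rule costs a multiple of `‖g‖²` from the gradient of the cutoff, hence the full
  -- `H¹` norm in the final bound.
  have hd : ∀ n x, ‖fderiv ℝ (fun x => χ n x * g n x) x‖ₑ ^ 2 ≤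
      2 * (‖fderiv ℝ (g n) x‖ₑ ^ 2 + L ^ 2 * ‖g n x‖ₑ ^ 2) := fun n x => by
    have h1 := (((hχ n).differentiable (by simp) x).hasFDerivAt.mul
      ((hg1 n).differentiable (by simp) x).hasFDerivAt).fderiv
    have h1' : fderiv ℝ (fun x => χ n x * g n x) x = _ := h1
    rw [h1', ← mul_pow]
    refine le_trans ?_ (ennreal_add_sq_le _ _)
    gcongr
    refine (enorm_add_le (χ n x • fderiv ℝ (g n) x) (g n x • fderiv ℝ (χ n) x)).trans ?_
    rw [enorm_smul, enorm_smul, mul_comm ‖g n x‖ₑ]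
    gcongr
    · exact mul_le_of_le_one_left' (hχ1 n x)
    · exact hχL n x
  have hle : ∀ n, ∫⁻ x, ‖χ n x * g n x‖ₑ ^ 4 ≤ (C * (2 * (L ^ 2 + 1)) : ℝ≥0) *
        ((∫⁻ x, ‖f x‖ₑ ^ 2) * ((∫⁻ x, ‖f x‖ₑ ^ 2) + ∫⁻ x, ‖G x‖ₑ ^ 2)) := fun n => by
    have h1 : ∫⁻ x, ‖χ n x * g n x‖ₑ ^ 2 ≤ ∫⁻ x, ‖f x‖ₑ ^ 2 := by
      refine (lintegral_mono fun x => ?_).trans (hgf n)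
      rw [enorm_mul]
      gcongr
      exact mul_le_of_le_one_left' (hχ1 n x)
    have hm : Measurable fun x => ‖g n x‖ₑ := (hg1 n).continuous.measurable.enorm
    have hm' : Measurable fun x => ‖fderiv ℝ (g n) x‖ₑ :=
      ((hg1 n).continuous_fderiv (by simp)).measurable.enorm
    have h2 : ∫⁻ x, ‖fderiv ℝ (fun x => χ n x * g n x) x‖ₑ ^ 2 ≤
        2 * ((∫⁻ x, ‖G x‖ₑ ^ 2) + L ^ 2 * ∫⁻ x, ‖f x‖ₑ ^ 2) := by
      refine (lintegral_mono (hd n)).trans ?_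
      rw [lintegral_const_mul' _ _ (by simp), lintegral_add_left (hm'.pow_const 2),
        lintegral_const_mul _ (hm.pow_const 2)]
      have a := hgG n
      have b := hgf n
      refine mul_le_mul_right (add_le_add a (mul_le_mul_right b _)) _
    refine (hC _ ((hχ n).mul (hg1 n)) ((hχc n).mul_right)).trans ?_
    refine (mul_le_mul_right (mul_le_mul' h1 h2) _).trans ?_
    push_cast
    rw [mul_assoc]
    refine mul_le_mul_right ?_ _
    rw [mul_left_comm (2 * ((L : ℝ≥0∞) ^ 2 + 1)), mul_assoc 2]
    refine mul_le_mul_right (mul_le_mul_right ?_ _) _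
    rw [add_mul, mul_add, mul_add, one_mul, one_mul, add_comm]
    refine add_le_add (le_self_add) le_add_self
  calc ∫⁻ x, ‖f x‖ₑ ^ 4
      = ∫⁻ x, liminf (fun n => ‖χ n x * g n x‖ₑ ^ 4) atTop := by
        refine lintegral_congr_ae ?_
        filter_upwards [hlim] with x h1
        have h2 : Tendsto (fun n => χ n x * g n x) atTop (𝓝 (f x)) := by
          refine h1.congr' ?_
          filter_upwards [hχlim x] with n hn
          rw [hn, one_mul]
        exact ((ENNReal.continuous_pow 4).tendsto _ |>.comp h2.enorm).liminf_eq.symm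
    _ ≤ liminf (fun n => ∫⁻ x, ‖χ n x * g n x‖ₑ ^ 4) atTop :=
        lintegral_liminf_le fun n =>
          ((hχ n).continuous.mul (hg1 n).continuous).measurable.enorm.pow_const 4
    _ ≤ _ := by
        refine liminf_le_of_le (by isBoundedDefault) fun b hb => ?_
        obtain ⟨n, hn⟩ := hb.exists
        exact hn.trans (hle n)

/-! ### The Hilbert space structure of `X` -/

namespace X

theorem memLp_weight (u : X) :
    MemLp (fun x => √(Real.log (1 + ‖x‖)) * u x) 2 := by
  have hm : AEStronglyMeasurable (fun x => √(Real.log (1 + ‖x‖)) * u x) volume :=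
    (measurable_log_weight.sqrt.aestronglyMeasurable).mul u.memLp.1
  rw [memLp_two_iff_integrable_sq hm]
  refine u.memX.2.congr (Eventually.of_forall fun x => ?_)
  simp only [mul_pow, Real.sq_sqrt (log_weight_nonneg x)]

/-- The embedding of `X` in `L²`, as a linear map. -/
def toL2ₗ : X →ₗ[ℝ] Lp ℝ 2 (volume : Measure Plane) where
  toFun u := u.toL2
  map_add' _ _ := rfl
  map_smul' _ _ := rfl

/-- The weak gradient, as a linear map to `L²`. -/
def gradₗ : X →ₗ[ℝ] Lp Plane 2 (volume : Measure Plane) where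
  toFun u := u.grad_memLp.toLp
  map_add' u v := by
    rw [← MemLp.toLp_add]
    exact MemLp.toLp_congr _ _ (grad_add u v)
  map_smul' c u := by
    rw [RingHom.id_apply, ← MemLp.toLp_const_smul]
    exact MemLp.toLp_congr _ _ (grad_smul c u)

/-- Multiplication by the square root of the weight, as a linear map to `L²`. -/
def weightₗ : X →ₗ[ℝ] Lp ℝ 2 (volume : Measure Plane) where
  toFun u := u.memLp_weight.toLp
  map_add' u v := by
    rw [← MemLp.toLp_add]
    refine MemLp.toLp_congr _ _ ?_
    filter_upwards [coe_add u v] with x hx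
    simp [hx, mul_add]
  map_smul' c u := by
    rw [RingHom.id_apply, ← MemLp.toLp_const_smul]
    refine MemLp.toLp_congr _ _ ?_
    filter_upwards [coe_smul c u] with x hx
    simp [hx, mul_left_comm]

theorem inner_gradₗ (u v : X) : ⟪gradₗ u, gradₗ v⟫_ℝ = ∫ x, ⟪u.grad x, v.grad x⟫_ℝ := by
  rw [L2.inner_def]
  refine integral_congr_ae ?_
  filter_upwards [u.grad_memLp.coeFn_toLp, v.grad_memLp.coeFn_toLp] with x h1 h2
  change ⟪(u.grad_memLp.toLp) x, (v.grad_memLp.toLp) x⟫_ℝ = _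
  rw [h1, h2]

theorem inner_toL2ₗ (u v : X) : ⟪toL2ₗ u, toL2ₗ v⟫_ℝ = ∫ x, u x * v x := by
  rw [L2.inner_def]
  refine integral_congr_ae (Eventually.of_forall fun x => ?_)
  change ⟪u x, v x⟫_ℝ = u x * v x
  exact mul_comm _ _

theorem inner_weightₗ (u v : X) :
    ⟪weightₗ u, weightₗ v⟫_ℝ = ∫ x, Real.log (1 + ‖x‖) * (u x * v x) := by
  rw [L2.inner_def]
  refine integral_congr_ae ?_
  filter_upwards [u.memLp_weight.coeFn_toLp, v.memLp_weight.coeFn_toLp] with x h1 h2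
  change ⟪(u.memLp_weight.toLp) x, (v.memLp_weight.toLp) x⟫_ℝ = _
  rw [h1, h2]
  have := Real.mul_self_sqrt (log_weight_nonneg x)
  simp only [RCLike.inner_apply, conj_trivial]
  linear_combination (u x * v x) * this

theorem integrable_inner_grad (u v : X) : Integrable fun x => ⟪u.grad x, v.grad x⟫_ℝ :=
  ((integrable_h1 u v).sub (u.memLp.integrable_mul v.memLp)).congr
    (Eventually.of_forall fun x => by simp)

theorem integral_h1_eq (u v : X) : ∫ x, (⟪u.grad x, v.grad x⟫_ℝ + u x * v x) =
    ⟪gradₗ u, gradₗ v⟫_ℝ + ⟪toL2ₗ u, toL2ₗ v⟫_ℝ := by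
  rw [inner_gradₗ, inner_toL2ₗ]
  exact integral_add (integrable_inner_grad u v) (u.memLp.integrable_mul v.memLp)

/-- `u ↦ (∇u, u, √log (1 + |x|) u)` is an isometry into a product of three `L²` spaces; boundedness
of the components and completeness of `X` rest on this. -/
theorem inner_eq (u v : X) : ⟪u, v⟫_ℝ =
    ⟪gradₗ u, gradₗ v⟫_ℝ + ⟪toL2ₗ u, toL2ₗ v⟫_ℝ + ⟪weightₗ u, weightₗ v⟫_ℝ := by
  rw [← integral_h1_eq, inner_weightₗ]
  rfl

theorem norm_sq_eq_add (u : X) :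
    ‖u‖ ^ 2 = ‖gradₗ u‖ ^ 2 + ‖toL2ₗ u‖ ^ 2 + ‖weightₗ u‖ ^ 2 := by
  simpa only [real_inner_self_eq_norm_sq] using inner_eq u u

/-- The embedding of `X` in `L²`. -/
def toL2L : X →L[ℝ] Lp ℝ 2 (volume : Measure Plane) :=
  toL2ₗ.mkContinuous 1 fun u => by
    rw [one_mul]
    refine le_of_sq_le_sq ?_ (norm_nonneg _)
    rw [norm_sq_eq_add u]
    nlinarith [sq_nonneg ‖gradₗ u‖, sq_nonneg ‖weightₗ u‖]

/-- The weak gradient, as an operator to `L²`. -/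
def gradL : X →L[ℝ] Lp Plane 2 (volume : Measure Plane) :=
  gradₗ.mkContinuous 1 fun u => by
    rw [one_mul]
    refine le_of_sq_le_sq ?_ (norm_nonneg _)
    rw [norm_sq_eq_add u]
    nlinarith [sq_nonneg ‖toL2ₗ u‖, sq_nonneg ‖weightₗ u‖]

/-- Multiplication by the square root of the weight, as an operator to `L²`. -/
def weightL : X →L[ℝ] Lp ℝ 2 (volume : Measure Plane) :=
  weightₗ.mkContinuous 1 fun u => by
    rw [one_mul]
    refine le_of_sq_le_sq ?_ (norm_nonneg _)
    rw [norm_sq_eq_add u]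
    nlinarith [sq_nonneg ‖gradₗ u‖, sq_nonneg ‖toL2ₗ u‖]

end X

/-- Tested against a fixed vector, both sides of the defining identity are `L²` scalar products with
fixed functions, hence continuous in `f` and `G`. -/
theorem hasWeakGradient_of_tendsto {f : ℕ → Lp ℝ 2 (volume : Measure Plane)}
    {G : ℕ → Lp Plane 2 (volume : Measure Plane)} {f' : Lp ℝ 2 (volume : Measure Plane)}
    {G' : Lp Plane 2 (volume : Measure Plane)} (h : ∀ n, HasWeakGradient (f n) (G n))
    (hf : Tendsto f atTop (𝓝 f')) (hG : Tendsto G atTop (𝓝 G')) : HasWeakGradient f' G' := by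
  intro φ hφ hc
  refine ext_inner_left ℝ fun v => ?_
  have hcont : Continuous (gradient φ) :=
    (InnerProductSpace.toDual ℝ Plane).symm.continuous.comp (hφ.continuous_fderiv (by simp))
  have hsupp : HasCompactSupport (gradient φ) :=
    (hc.fderiv (𝕜 := ℝ)).comp_left (g := (InnerProductSpace.toDual ℝ Plane).symm) (map_zero _)
  have hp : MemLp (fun x => ⟪v, gradient φ x⟫_ℝ) 2 volume :=
    (continuous_const.inner hcont).memLp_of_hasCompactSupport
      (hsupp.comp_left (g := fun y => ⟪v, y⟫_ℝ) (inner_zero_right _))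
  have hq : MemLp (fun x => φ x • v) 2 volume :=
    (hφ.continuous.smul continuous_const).memLp_of_hasCompactSupport hc.smul_right
  have e1 : ∀ f : Lp ℝ 2 (volume : Measure Plane),
      ⟪v, ∫ x, f x • gradient φ x⟫_ℝ = ⟪f, hp.toLp⟫_ℝ := fun f => by
    rw [← integral_inner (integrable_smul_gradient (Lp.memLp f) hφ hc), L2.inner_def]
    refine integral_congr_ae ?_
    filter_upwards [hp.coeFn_toLp] with x hx
    rw [hx, inner_smul_right]
    simp [mul_comm]
  have e2 : ∀ G : Lp Plane 2 (volume : Measure Plane),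
      ⟪v, -∫ x, φ x • G x⟫_ℝ = -⟪G, hq.toLp⟫_ℝ := fun G => by
    rw [inner_neg_right, ← integral_inner (integrable_smul_field (Lp.memLp G) hφ hc), L2.inner_def]
    congr 1
    refine integral_congr_ae ?_
    filter_upwards [hq.coeFn_toLp] with x hx
    rw [hx, inner_smul_right, inner_smul_right, real_inner_comm]
  rw [e1, e2]
  refine tendsto_nhds_unique (hf.inner tendsto_const_nhds)
    (((hG.inner tendsto_const_nhds).neg).congr fun n => ?_)
  rw [← e1, ← e2, h n φ hφ hc]

/-- The three `L²` components of a Cauchy sequence converge, and the limits of the gradient and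
weighted components are those of the limit function. -/
instance : CompleteSpace X := by
  refine Metric.complete_of_cauchySeq_tendsto fun u hu => ?_
  obtain ⟨f, hf⟩ := cauchySeq_tendsto_of_complete (X.toL2L.uniformContinuous.comp_cauchySeq hu)
  obtain ⟨G, hG⟩ := cauchySeq_tendsto_of_complete (X.gradL.uniformContinuous.comp_cauchySeq hu)
  obtain ⟨w, hw⟩ := cauchySeq_tendsto_of_complete (X.weightL.uniformContinuous.comp_cauchySeq hu)
  have hfG : HasWeakGradient f G :=
    hasWeakGradient_of_tendsto (fun n φ hφ hc => ?_) hf hG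
  swap
  · rw [show ∫ x, ((X.toL2L ∘ u) n) x • gradient φ x = ∫ x, u n x • gradient φ x from rfl,
      (u n).grad_hasWeakGradient φ hφ hc]
    congr 1
    refine integral_congr_ae ?_
    filter_upwards [(u n).grad_memLp.coeFn_toLp] with x hx
    exact congrArg (φ x • ·) hx.symm
  -- Along a common subsequence both sequences converge almost everywhere, which identifies the
  -- weighted limit.
  have hwf : (fun x => √(Real.log (1 + ‖x‖)) * f x) =ᵐ[volume] w := by
    obtain ⟨s, hs, hs'⟩ := (tendstoInMeasure_of_tendsto_Lp hf).exists_seq_tendsto_ae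
    obtain ⟨t, ht, ht'⟩ := (tendstoInMeasure_of_tendsto_Lp
      (hw.comp hs.tendsto_atTop)).exists_seq_tendsto_ae
    have hall : ∀ᵐ x, ∀ n, (X.weightL (u n)) x = √(Real.log (1 + ‖x‖)) * u n x :=
      ae_all_iff.2 fun n => (u n).memLp_weight.coeFn_toLp
    filter_upwards [hs', ht', hall] with x h1 h2 h3
    refine tendsto_nhds_unique ((h1.comp ht.tendsto_atTop).const_mul _) (h2.congr fun n => ?_)
    exact h3 _
  have hX : MemX f := by
    refine ⟨⟨Lp.memLp f, G, Lp.memLp G, hfG⟩, ?_⟩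
    have := ((Lp.memLp w).ae_eq hwf.symm).integrable_sq
    refine this.congr (Eventually.of_forall fun x => ?_)
    simp only [mul_pow, Real.sq_sqrt (log_weight_nonneg x)]
  let v : X := ⟨f, hX⟩
  have h1 : X.toL2ₗ v = f := rfl
  have h2 : X.gradₗ v = G := by
    refine Lp.ext (v.grad_memLp.coeFn_toLp.trans ?_)
    exact v.grad_hasWeakGradient.ae_unique hfG EventuallyEq.rfl v.grad_memLp (Lp.memLp G)
  have h3 : X.weightₗ v = w := Lp.ext (v.memLp_weight.coeFn_toLp.trans hwf)
  refine ⟨v, ?_⟩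
  rw [tendsto_iff_norm_sub_tendsto_zero] at hf hG hw ⊢
  have hsum := ((hG.pow 2).add (hf.pow 2)).add (hw.pow 2)
  have hn : ∀ n, ‖u n - v‖ ^ 2 = ‖(X.gradL ∘ u) n - G‖ ^ 2 + ‖(X.toL2L ∘ u) n - f‖ ^ 2 +
      ‖(X.weightL ∘ u) n - w‖ ^ 2 := fun n => by
    rw [X.norm_sq_eq_add, map_sub, map_sub, map_sub, h1, h2, h3]
    rfl
  simp only [← hn] at hsum
  have := hsum.sqrt
  simpa [Real.sqrt_sq (norm_nonneg _)] using this

theorem lintegral_sq_eq_enorm_toLp {E : Type*} [NormedAddCommGroup E] {f : Plane → E}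
    (hf : MemLp f 2) : ∫⁻ x, ‖f x‖ₑ ^ 2 = ‖hf.toLp‖ₑ ^ 2 := by
  rw [Lp.enorm_toLp, eLpNorm_eq_lintegral_rpow_enorm_toReal (by simp) (by simp)]
  simp only [ENNReal.toReal_ofNat, ENNReal.rpow_two]
  rw [← ENNReal.rpow_two, ← ENNReal.rpow_mul]
  norm_num

/-! ### Compactness of the embedding of `X` in `L²` -/

namespace X

theorem measurable (u : X) : Measurable u := (Lp.stronglyMeasurable u.toL2).measurable

theorem enorm_toL2L_le (u : X) : ‖toL2L u‖ₑ ≤ ‖u‖ₑ := by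
  rw [enorm_le_iff_norm_le]
  refine le_of_sq_le_sq ?_ (norm_nonneg _)
  rw [norm_sq_eq_add u]
  change ‖toL2ₗ u‖ ^ 2 ≤ _
  nlinarith [sq_nonneg ‖gradₗ u‖, sq_nonneg ‖weightₗ u‖]

theorem lintegral_sq_eq (u : X) : ∫⁻ x, ‖u x‖ₑ ^ 2 = ‖toL2L u‖ₑ ^ 2 := by
  rw [lintegral_sq_eq_enorm_toLp u.memLp]
  congr 2
  exact Lp.toLp_coeFn _ _

theorem lintegral_sq_le (u : X) : ∫⁻ x, ‖u x‖ₑ ^ 2 ≤ ‖u‖ₑ ^ 2 := by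
  rw [lintegral_sq_eq]
  exact pow_le_pow_left' (enorm_toL2L_le u) 2

theorem lintegral_grad_sq_le (u : X) : ∫⁻ x, ‖u.grad x‖ₑ ^ 2 ≤ ‖u‖ₑ ^ 2 := by
  rw [lintegral_sq_eq_enorm_toLp u.grad_memLp]
  refine pow_le_pow_left' (enorm_le_iff_norm_le.2 (le_of_sq_le_sq ?_ (norm_nonneg _))) 2
  rw [norm_sq_eq_add u]
  change ‖gradₗ u‖ ^ 2 ≤ _
  nlinarith [sq_nonneg ‖toL2ₗ u‖, sq_nonneg ‖weightₗ u‖]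

theorem lintegral_log_sq_le (u : X) :
    ∫⁻ x, ENNReal.ofReal (Real.log (1 + ‖x‖)) * ‖u x‖ₑ ^ 2 ≤ ‖u‖ₑ ^ 2 := by
  have : ∫⁻ x, ENNReal.ofReal (Real.log (1 + ‖x‖)) * ‖u x‖ₑ ^ 2 =
      ∫⁻ x, ‖√(Real.log (1 + ‖x‖)) * u x‖ₑ ^ 2 := by
    refine lintegral_congr fun x => ?_
    rw [enorm_mul, mul_pow, Real.enorm_of_nonneg (Real.sqrt_nonneg _),
      ← ENNReal.ofReal_pow (Real.sqrt_nonneg _), Real.sq_sqrt (log_weight_nonneg x)]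
  rw [this, lintegral_sq_eq_enorm_toLp u.memLp_weight]
  refine pow_le_pow_left' (enorm_le_iff_norm_le.2 (le_of_sq_le_sq ?_ (norm_nonneg _))) 2
  rw [norm_sq_eq_add u]
  change ‖weightₗ u‖ ^ 2 ≤ _
  nlinarith [sq_nonneg ‖toL2ₗ u‖, sq_nonneg ‖gradₗ u‖]

/-- The average of `u` over the ball of radius `r` around `x`. -/
def ballAverage (r : ℝ) (x : Plane) : X →L[ℝ] ℝ :=
  (volume.real (Metric.ball (0 : Plane) r))⁻¹ •
    (innerSL ℝ (indicatorConstLp 2 (measurableSet_ball (x := x) (ε := r))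
      measure_ball_lt_top.ne (1 : ℝ))).comp toL2L

theorem ballAverage_apply (r : ℝ) (x : Plane) (u : X) : ballAverage r x u =
    ∫ h, u (x + h) ∂(ProbabilityTheory.cond volume (Metric.ball (0 : Plane) r)) := by
  have h1 : ∫ y in Metric.ball x r, u y = ∫ h in Metric.ball (0 : Plane) r, u (x + h) := by
    have := (measurePreserving_add_left volume x).setIntegral_preimage_emb
      (MeasurableEquiv.addLeft x).measurableEmbedding u (Metric.ball x r)
    rw [← this]
    congr 2
    ext y
    simp
  have h2 : ballAverage r x u =
      (volume.real (Metric.ball (0 : Plane) r))⁻¹ * ∫ y in Metric.ball x r, u y := by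
    rw [← L2.inner_indicatorConstLp_one (𝕜 := ℝ) measurableSet_ball measure_ball_lt_top.ne u.toL2]
    rfl
  rw [h2, h1, ProbabilityTheory.cond, integral_smul_measure, ENNReal.toReal_inv, Measure.real]
  rfl

variable {r : ℝ}

theorem integrable_translate (u : X) (x : Plane) :
    Integrable (fun h => u (x + h))
      (ProbabilityTheory.cond volume (Metric.ball (0 : Plane) r)) := by
  have h1 : MemLp (fun h => u (x + h)) 2 volume :=
    u.memLp.comp_measurePreserving (measurePreserving_add_left volume x)
  have h2 : LocallyIntegrable (fun h => u (x + h)) := h1.locallyIntegrable (by norm_num)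
  have h3 := (h2.integrableOn_isCompact (isCompact_closedBall (0 : Plane) r)).mono_set
    Metric.ball_subset_closedBall
  rcases (le_or_gt r 0) with hr | hr
  · rw [Metric.ball_eq_empty.2 hr]
    simp
  · exact Integrable.smul_measure h3 (ENNReal.inv_ne_top.2 (Metric.measure_ball_pos _ _ hr).ne')

theorem isProbabilityMeasure_cond_ball (hr : 0 < r) :
    IsProbabilityMeasure (ProbabilityTheory.cond volume (Metric.ball (0 : Plane) r)) :=
  ProbabilityTheory.cond_isProbabilityMeasure_of_finite (Metric.measure_ball_pos _ _ hr).ne'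
    measure_ball_lt_top.ne

theorem enorm_integral_sq_le {α : Type*} [MeasurableSpace α] {μ : Measure α}
    [IsProbabilityMeasure μ] {f : α → ℝ} (hf : AEStronglyMeasurable f μ) :
    ‖∫ a, f a ∂μ‖ₑ ^ 2 ≤ ∫⁻ a, ‖f a‖ₑ ^ 2 ∂μ := by
  refine (pow_le_pow_left' (enorm_integral_le_lintegral_enorm f) 2).trans ?_
  simpa using LogChoquard.lintegral_sq_le μ (w := fun _ => 1) hf.enorm aemeasurable_const

/-- The difference is an average of `u (x + h) - u x` over `|h| < r`; Jensen and the Lipschitz bound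
for translations apply. -/
theorem lintegral_sub_ballAverage_sq_le (hr : 0 < r) (u : X) :
    ∫⁻ x, ‖u x - ballAverage r x u‖ₑ ^ 2 ≤ ENNReal.ofReal r ^ 2 * ‖u‖ₑ ^ 2 := by
  have := isProbabilityMeasure_cond_ball hr
  set ν := ProbabilityTheory.cond volume (Metric.ball (0 : Plane) r) with hν
  have hum := u.measurable
  calc ∫⁻ x, ‖u x - ballAverage r x u‖ₑ ^ 2
      ≤ ∫⁻ x, ∫⁻ h, ‖u (x + h) - u x‖ₑ ^ 2 ∂ν := by
        refine lintegral_mono fun x => ?_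
        have : ballAverage r x u - u x = ∫ h, (u (x + h) - u x) ∂ν := by
          rw [integral_sub (integrable_translate u x) (integrable_const _), ballAverage_apply]
          simp
        rw [enorm_sub_rev, this]
        exact enorm_integral_sq_le
          ((hum.comp (measurable_const_add x)).sub_const _).aestronglyMeasurable
    _ = ∫⁻ h, (∫⁻ x, ‖u (x + h) - u x‖ₑ ^ 2) ∂ν := by
        refine lintegral_lintegral_swap (Measurable.aemeasurable ?_)
        have h1 : Measurable fun p : Plane × Plane => u (p.1 + p.2) - u p.1 :=
          (hum.comp measurable_add).sub (hum.comp measurable_fst)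
        exact h1.enorm.pow_const 2
    _ ≤ ∫⁻ h, ENNReal.ofReal r ^ 2 * ‖u‖ₑ ^ 2 ∂ν := by
        have hae : ∀ᵐ h ∂ν, h ∈ Metric.ball (0 : Plane) r :=
          ProbabilityTheory.ae_cond_mem measurableSet_ball
        refine lintegral_mono_ae (hae.mono fun h hh => ?_)
        refine (u.grad_hasWeakGradient.lintegral_translate_sub_sq_le
          u.memLp u.grad_memLp h).trans ?_
        refine mul_le_mul' (pow_le_pow_left' ?_ 2) u.lintegral_grad_sq_le
        rw [← ofReal_norm]
        exact ENNReal.ofReal_le_ofReal (mem_ball_zero_iff.1 hh).le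
    _ = _ := by simp

/-- The averages are Lipschitz in the centre, uniformly on bounded sets of `X`, so finitely many
centres control all averages over a bounded region. -/
theorem ballAverage_sub_sq_le (hr : 0 < r) (u : X) (x y : Plane) :
    ‖ballAverage r x u - ballAverage r y u‖ₑ ^ 2 ≤
      (volume (Metric.ball (0 : Plane) r))⁻¹ * (‖x - y‖ₑ ^ 2 * ‖u‖ₑ ^ 2) := by
  have := isProbabilityMeasure_cond_ball hr
  set ν := ProbabilityTheory.cond volume (Metric.ball (0 : Plane) r) with hν
  have hum := u.measurable
  have h1 : ballAverage r x u - ballAverage r y u = ∫ h, (u (x + h) - u (y + h)) ∂ν := by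
    rw [integral_sub (integrable_translate u x) (integrable_translate u y), ballAverage_apply,
      ballAverage_apply]
  rw [h1]
  refine (enorm_integral_sq_le ((hum.comp (measurable_const_add x)).sub
    (hum.comp (measurable_const_add y))).aestronglyMeasurable).trans ?_
  rw [hν, ProbabilityTheory.cond, lintegral_smul_measure, smul_eq_mul]
  refine mul_le_mul_right ?_ _
  calc ∫⁻ h in Metric.ball (0 : Plane) r, ‖u (x + h) - u (y + h)‖ₑ ^ 2
      ≤ ∫⁻ h, ‖u (x + h) - u (y + h)‖ₑ ^ 2 := setLIntegral_le_lintegral _ _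
    _ = ∫⁻ h, ‖u (h + (x - y)) - u h‖ₑ ^ 2 := by
        rw [← lintegral_add_left_eq_self (fun h => ‖u (h + (x - y)) - u h‖ₑ ^ 2) y]
        refine lintegral_congr fun h => ?_
        rw [show y + h + (x - y) = x + h by abel]
    _ ≤ ‖x - y‖ₑ ^ 2 * ‖u‖ₑ ^ 2 :=
        (u.grad_hasWeakGradient.lintegral_translate_sub_sq_le u.memLp u.grad_memLp _).trans
          (mul_le_mul_right u.lintegral_grad_sq_le _)

/-- Chebyshev's inequality: outside the ball the weight is at least `log (1 + R)`. -/
theorem lintegral_compl_ball_sq_le {R : ℝ} (hR : 0 < R) (u : X) :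
    ∫⁻ x in (Metric.closedBall (0 : Plane) R)ᶜ, ‖u x‖ₑ ^ 2 ≤
      ENNReal.ofReal (Real.log (1 + R))⁻¹ * ‖u‖ₑ ^ 2 := by
  have hl : 0 < Real.log (1 + R) := Real.log_pos (by linarith)
  calc ∫⁻ x in (Metric.closedBall (0 : Plane) R)ᶜ, ‖u x‖ₑ ^ 2
      ≤ ∫⁻ x in (Metric.closedBall (0 : Plane) R)ᶜ, ENNReal.ofReal (Real.log (1 + R))⁻¹ *
          (ENNReal.ofReal (Real.log (1 + ‖x‖)) * ‖u x‖ₑ ^ 2) := by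
        refine setLIntegral_mono' measurableSet_closedBall.compl fun x hx => ?_
        rw [← mul_assoc, ← ENNReal.ofReal_mul (by positivity)]
        refine le_mul_of_one_le_left' ?_
        rw [← ENNReal.ofReal_one]
        refine ENNReal.ofReal_le_ofReal ?_
        rw [inv_mul_eq_div, one_le_div hl]
        have : R < ‖x‖ := by simpa using hx
        exact Real.log_le_log (by linarith) (by linarith)
    _ ≤ _ := by
        rw [lintegral_const_mul' _ _ ENNReal.ofReal_ne_top]
        exact mul_le_mul_right ((setLIntegral_le_lintegral _ _).trans u.lintegral_log_sq_le) _

/-- The embedding of `X` in `L²` is compact. -/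
theorem isCompactOperator_toL2L : IsCompactOperator toL2L := by
  refine isCompactOperator_of_forall_le toL2L fun η hη => ?_
  -- The error has three sources, each allowed `η² / 3`: the tail beyond `R`, the replacement of `u`
  -- by its averages over balls of radius `r`, and the restriction to a `δ`-net of centres.
  obtain ⟨R, hR, hRη⟩ : ∃ R : ℝ, 0 < R ∧ (Real.log (1 + R))⁻¹ ≤ η ^ 2 / 3 := by
    have h1 : Tendsto (fun R : ℝ => (Real.log (1 + R))⁻¹) atTop (𝓝 0) :=
      (Real.tendsto_log_atTop.comp (tendsto_atTop_add_const_left _ 1 tendsto_id)).inv_tendsto_atTop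
    exact ((eventually_gt_atTop 0).and (h1.eventually_le_const (by positivity))).exists
  obtain ⟨r, hr, hrη⟩ : ∃ r : ℝ, 0 < r ∧ 2 * r ^ 2 ≤ η ^ 2 / 3 :=
    ⟨η / 3, by positivity, by nlinarith⟩
  set m := volume.real (Metric.ball (0 : Plane) r) with hm
  set v := volume.real (Metric.closedBall (0 : Plane) R) with hv
  have hm0 : 0 < m := ENNReal.toReal_pos (Metric.measure_ball_pos _ _ hr).ne'
    measure_ball_lt_top.ne
  have hv0 : 0 ≤ v := measureReal_nonneg
  obtain ⟨δ, hδ, hδη⟩ : ∃ δ : ℝ, 0 < δ ∧ 4 * v * m⁻¹ * δ ^ 2 ≤ η ^ 2 / 3 := by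
    have h1 : Tendsto (fun δ : ℝ => 4 * v * m⁻¹ * δ ^ 2) (𝓝[>] 0) (𝓝 0) := by
      have : Continuous (fun δ : ℝ => 4 * v * m⁻¹ * δ ^ 2) := by fun_prop
      simpa using (this.tendsto 0).mono_left nhdsWithin_le_nhds
    exact ((eventually_mem_nhdsWithin (s := Ioi (0 : ℝ))).and
      (h1.eventually_le_const (by positivity))).exists
  obtain ⟨t, -, htf, hcov⟩ :=
    (isCompact_closedBall (0 : Plane) R).finite_cover_balls hδ
  -- The dominating compact operator has finite rank: the averages at the points of the net.
  let S₀ : X →L[ℝ] (t → ℝ) := ContinuousLinearMap.pi fun x : t => ballAverage r x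
  have := htf.fintype
  refine ⟨t → ℝ, inferInstance, inferInstance, √(4 * v) • S₀, ?_, fun u => ?_⟩
  · have h := isCompactOperator_id (E := t → ℝ)
    exact h.comp_clm (√(4 * v) • S₀)
  have hn : ‖u‖ₑ ^ 2 = ENNReal.ofReal (‖u‖ ^ 2) := by
    rw [← ofReal_norm, ENNReal.ofReal_pow (norm_nonneg _)]
  have hM : ∀ x ∈ Metric.closedBall (0 : Plane) R, ‖ballAverage r x u‖ₑ ^ 2 ≤
      ENNReal.ofReal (2 * (‖S₀ u‖ ^ 2 + m⁻¹ * δ ^ 2 * ‖u‖ ^ 2)) := fun x hx => by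
    obtain ⟨y, hy, hxy⟩ := mem_iUnion₂.1 (hcov hx)
    have h1 := ballAverage_sub_sq_le hr u x y
    rw [hn, ← ofReal_norm (x - y), ← ENNReal.ofReal_pow (norm_nonneg _), ← ofReal_norm,
      ← ENNReal.ofReal_pow (norm_nonneg _), ← ofReal_measureReal measure_ball_lt_top.ne,
      ← ENNReal.ofReal_inv_of_pos hm0, ← ENNReal.ofReal_mul (by positivity),
      ← ENNReal.ofReal_mul (by positivity), ENNReal.ofReal_le_ofReal_iff (by positivity)] at h1
    rw [← ofReal_norm, ← ENNReal.ofReal_pow (norm_nonneg _)]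
    refine ENNReal.ofReal_le_ofReal ?_
    have h2 : ‖ballAverage r y u‖ ≤ ‖S₀ u‖ := norm_le_pi_norm (S₀ u) ⟨y, hy⟩
    have h3 : ‖x - y‖ ^ 2 ≤ δ ^ 2 :=
      pow_le_pow_left₀ (norm_nonneg _) (by rw [← dist_eq_norm]; exact (Metric.mem_ball.1 hxy).le) 2
    have h4 : m⁻¹ * (‖x - y‖ ^ 2 * ‖u‖ ^ 2) ≤ m⁻¹ * δ ^ 2 * ‖u‖ ^ 2 := by
      rw [mul_assoc]; gcongr
    have h5 : ‖ballAverage r y u‖ ^ 2 ≤ ‖S₀ u‖ ^ 2 := pow_le_pow_left₀ (norm_nonneg _) h2 2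
    simp only [Real.norm_eq_abs, sq_abs] at h1 h5 ⊢
    nlinarith [sq_nonneg (ballAverage r x u - 2 * ballAverage r y u)]
  have hB : ∫⁻ x in Metric.closedBall (0 : Plane) R, ‖u x‖ₑ ^ 2 ≤
      2 * (ENNReal.ofReal r ^ 2 * ‖u‖ₑ ^ 2 +
        ENNReal.ofReal (2 * (‖S₀ u‖ ^ 2 + m⁻¹ * δ ^ 2 * ‖u‖ ^ 2)) * ENNReal.ofReal v) := by
    calc ∫⁻ x in Metric.closedBall (0 : Plane) R, ‖u x‖ₑ ^ 2
        ≤ ∫⁻ x in Metric.closedBall (0 : Plane) R, 2 * (‖u x - ballAverage r x u‖ₑ ^ 2 +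
            ENNReal.ofReal (2 * (‖S₀ u‖ ^ 2 + m⁻¹ * δ ^ 2 * ‖u‖ ^ 2))) := by
          refine setLIntegral_mono' measurableSet_closedBall fun x hx => ?_
          calc ‖u x‖ₑ ^ 2 = ‖u x - ballAverage r x u + ballAverage r x u‖ₑ ^ 2 := by
                rw [sub_add_cancel]
            _ ≤ (‖u x - ballAverage r x u‖ₑ + ‖ballAverage r x u‖ₑ) ^ 2 :=
                pow_le_pow_left' (enorm_add_le _ _) 2
            _ ≤ _ := (ennreal_add_sq_le _ _).trans
                (mul_le_mul_right (add_le_add_right (hM x hx) _) _)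
      _ ≤ _ := by
          rw [lintegral_const_mul' _ _ (by simp), lintegral_add_right _ measurable_const,
            setLIntegral_const, ← ofReal_measureReal measure_closedBall_lt_top.ne]
          exact mul_le_mul_right (add_le_add_left ((setLIntegral_le_lintegral _ _).trans
            (lintegral_sub_ballAverage_sq_le hr u)) _) _
  have hsum : ‖toL2L u‖ ^ 2 ≤ 4 * v * ‖S₀ u‖ ^ 2 + η ^ 2 * ‖u‖ ^ 2 := by
    have h2r : (2 : ℝ≥0∞) = ENNReal.ofReal 2 := by simp
    have h1 := add_le_add (hB.trans_eq (congrArg (· * _) h2r)) (lintegral_compl_ball_sq_le hR u)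
    have hl : 0 ≤ (Real.log (1 + R))⁻¹ := inv_nonneg.2 (Real.log_nonneg (by linarith))
    rw [lintegral_add_compl _ measurableSet_closedBall, lintegral_sq_eq, hn, ← ofReal_norm,
      ← ENNReal.ofReal_pow (norm_nonneg _), ← ENNReal.ofReal_pow hr.le,
      ← ENNReal.ofReal_mul (by positivity), ← ENNReal.ofReal_mul (by positivity),
      ← ENNReal.ofReal_mul (by positivity), ← ENNReal.ofReal_add (by positivity) (by positivity),
      ← ENNReal.ofReal_mul (by positivity), ← ENNReal.ofReal_add (by positivity)
        (by positivity), ENNReal.ofReal_le_ofReal_iff (by positivity)] at h1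
    have hu0 : 0 ≤ ‖u‖ ^ 2 := by positivity
    nlinarith [mul_le_mul_of_nonneg_right hRη hu0, mul_le_mul_of_nonneg_right hrη hu0,
      mul_le_mul_of_nonneg_right hδη hu0]
  refine le_of_sq_le_sq (hsum.trans ?_) (by positivity)
  rw [_root_.smul_apply, norm_smul, Real.norm_of_nonneg (Real.sqrt_nonneg _), add_sq,
    mul_pow, Real.sq_sqrt (by positivity), mul_pow]
  have : 0 ≤ 2 * (√(4 * v) * ‖S₀ u‖) * (η * ‖u‖) := by positivity
  linarith

end X

/-! ### Pointwise bounds for the logarithmic kernel -/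

/-- The weight `log (1 + |x|)` with values in `[0, ∞]`. -/
def elogWeight (x : Plane) : ℝ≥0∞ := ENNReal.ofReal (Real.log (1 + ‖x‖))

/-- The singular part of the logarithmic kernel. -/
def elogSingular (z : Plane) : ℝ≥0∞ :=
  (Metric.ball (0 : Plane) 1).indicator (fun z => ‖Real.log ‖z‖‖ₑ) z

theorem measurable_elogWeight : Measurable elogWeight := measurable_log_weight.ennreal_ofReal

theorem measurable_elogSingular : Measurable elogSingular :=
  (Real.measurable_log.comp measurable_norm).enorm.indicator measurableSet_ball

theorem elogSingular_sub_comm (x y : Plane) : elogSingular (x - y) = elogSingular (y - x) := by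
  simp only [elogSingular, indicator, mem_ball_zero_iff, norm_sub_rev]

/-- For `|x - y| ≥ 1` this is `|x - y| ≤ (1 + |x|) (1 + |y|)`; otherwise the singular part alone
suffices. -/
theorem enorm_log_le (x y : Plane) :
    ‖Real.log ‖x - y‖‖ₑ ≤ elogWeight x + elogWeight y + elogSingular (x - y) := by
  by_cases h : ‖x - y‖ < 1
  · have : elogSingular (x - y) = ‖Real.log ‖x - y‖‖ₑ := by simp [elogSingular, h]
    rw [this]
    exact le_add_self
  · push Not at h
    refine le_trans ?_ le_self_add
    rw [elogWeight, elogWeight, ← ENNReal.ofReal_add (log_weight_nonneg x) (log_weight_nonneg y),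
      Real.enorm_of_nonneg (Real.log_nonneg h)]
    refine ENNReal.ofReal_le_ofReal ?_
    rw [← Real.log_mul (by positivity) (by positivity)]
    refine Real.log_le_log (by linarith) ?_
    nlinarith [norm_sub_le x y, norm_nonneg x, norm_nonneg y,
      mul_nonneg (norm_nonneg x) (norm_nonneg y)]

/-- No weight in `x` remains on the right, because `1 + |x|` and `|x - y|` are comparable up to a
factor `2 (1 + |y|)` when `|x - y| ≥ 1`. When `|x - y| < 1`, `log (1 + |x|)` itself is at most `log
2 + log (1 + |y|)`. -/
theorem enorm_log_sub_le (x y : Plane) :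
    ‖Real.log ‖x - y‖ - Real.log (1 + ‖x‖)‖ₑ ≤ elogWeight y + 1 + elogSingular (x - y) := by
  have hlog2 : Real.log 2 ≤ 1 := by linarith [Real.log_two_lt_d9]
  have hy := log_weight_nonneg y
  have hx := log_weight_nonneg x
  have htri : ‖x‖ ≤ ‖x - y‖ + ‖y‖ := by simpa using norm_add_le (x - y) y
  have hone : (1 : ℝ≥0∞) = ENNReal.ofReal 1 := by simp
  rw [elogWeight, hone, ← ENNReal.ofReal_add hy zero_le_one]
  by_cases h : ‖x - y‖ < 1
  · have : elogSingular (x - y) = ‖Real.log ‖x - y‖‖ₑ := by simp [elogSingular, h]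
    rw [this, add_comm (ENNReal.ofReal _)]
    refine enorm_sub_le.trans (add_le_add_right ?_ _)
    rw [Real.enorm_of_nonneg hx]
    refine ENNReal.ofReal_le_ofReal ?_
    have : Real.log (1 + ‖x‖) ≤ Real.log (2 * (1 + ‖y‖)) :=
      Real.log_le_log (by positivity) (by linarith [norm_nonneg y])
    rw [Real.log_mul (by norm_num) (by positivity)] at this
    linarith
  · push Not at h
    refine le_trans ?_ le_self_add
    rw [← ofReal_norm]
    refine ENNReal.ofReal_le_ofReal (abs_le.2 ⟨?_, ?_⟩)
    · have : Real.log (1 + ‖x‖) ≤ Real.log (2 * ‖x - y‖ * (1 + ‖y‖)) :=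
        Real.log_le_log (by positivity) (by nlinarith [norm_nonneg y])
      rw [Real.log_mul (by positivity) (by positivity), Real.log_mul (by norm_num) (by positivity)]
        at this
      linarith
    · have : Real.log ‖x - y‖ ≤ Real.log ((1 + ‖x‖) * (1 + ‖y‖)) := by
        refine Real.log_le_log (by linarith) ?_
        nlinarith [norm_sub_le x y, norm_nonneg x, norm_nonneg y,
          mul_nonneg (norm_nonneg x) (norm_nonneg y)]
      rw [Real.log_mul (by positivity) (by positivity)] at this
      linarith

theorem lintegral_elogSingular_sq_lt_top : ∫⁻ z, elogSingular z ^ 2 < ⊤ := by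
  have h1 : IntegrableOn (fun z : Plane => Real.log ‖z‖ ^ 2) (Metric.ball 0 1) := by
    rw [integrableOn_fun_norm_addHaar volume (f := fun y => Real.log y ^ 2)]
    simp only [finrank_euclideanSpace, Fintype.card_fin, Nat.add_one_sub_one, pow_one, smul_eq_mul]
    -- In polar coordinates the integrand is `r log² r = (r^{1/2} log r)²`, and `|r^{1/2} log r| <
    -- 2` on `(0, 1)`.
    refine Measure.integrableOn_of_bounded (M := 4) (by simp)
      (measurable_id.mul (Real.measurable_log.pow_const 2)).aestronglyMeasurable ?_
    refine (ae_restrict_iff' measurableSet_Ioo).2 (Eventually.of_forall fun y hy => ?_)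
    have h := Real.abs_log_mul_self_rpow_lt y (1 / 2) hy.1 hy.2.le (by norm_num)
    have h2 : y * Real.log y ^ 2 = |Real.log y * y ^ (1 / 2 : ℝ)| ^ 2 := by
      rw [sq_abs, mul_pow, ← Real.rpow_natCast (y ^ (1 / 2 : ℝ)), ← Real.rpow_mul hy.1.le]
      norm_num
      ring
    rw [h2, Real.norm_of_nonneg (by positivity)]
    nlinarith [abs_nonneg (Real.log y * y ^ (1 / 2 : ℝ))]
  have h2 : ∫⁻ z, elogSingular z ^ 2 = ∫⁻ z in Metric.ball (0 : Plane) 1, ‖Real.log ‖z‖ ^ 2‖ₑ := by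
    rw [← lintegral_indicator measurableSet_ball]
    refine lintegral_congr fun z => ?_
    by_cases hz : z ∈ Metric.ball (0 : Plane) 1 <;> simp [elogSingular, hz, enorm_pow]
  rw [h2]
  exact h1.2

theorem ennreal_le_of_sq_le {a b : ℝ≥0∞} (h : a ^ 2 ≤ b ^ 2) : a ≤ b := by
  by_contra! hlt
  exact absurd h (not_le.2 (ENNReal.pow_lt_pow_left two_ne_zero hlt))

/-! ### Integral bounds for the logarithmic interaction -/

namespace X

theorem measurable_enorm (u : X) : Measurable fun x => ‖u x‖ₑ := u.measurable.enorm

theorem lintegral_mul_le (f g : X) : ∫⁻ x, ‖f x‖ₑ * ‖g x‖ₑ ≤ ‖toL2L f‖ₑ * ‖toL2L g‖ₑ := by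
  refine ennreal_le_of_sq_le ?_
  rw [mul_pow, ← lintegral_sq_eq, ← lintegral_sq_eq]
  exact lintegral_mul_sq_le _ f.measurable_enorm.aemeasurable g.measurable_enorm.aemeasurable

theorem lintegral_mul_le' (f g : X) : ∫⁻ x, ‖f x‖ₑ * ‖g x‖ₑ ≤ ‖f‖ₑ * ‖g‖ₑ :=
  (lintegral_mul_le f g).trans (mul_le_mul' f.enorm_toL2L_le g.enorm_toL2L_le)

/-- Cauchy–Schwarz with the weight split into two square roots. The restriction to `s` is kept on
`f` so that its tails can be made small. -/
theorem lintegral_restrict_elogWeight_mul_sq_le (s : Set Plane) (f g : X) :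
    (∫⁻ x in s, elogWeight x * (‖f x‖ₑ * ‖g x‖ₑ)) ^ 2 ≤
      (∫⁻ x in s, elogWeight x * ‖f x‖ₑ ^ 2) * ‖g‖ₑ ^ 2 := by
  have hsq : ∀ x, (elogWeight x ^ (1 / 2 : ℝ)) ^ 2 = elogWeight x := fun a => by
    rw [← ENNReal.rpow_two, ← ENNReal.rpow_mul]; norm_num
  have hm := (measurable_elogWeight.pow_const (1 / 2 : ℝ))
  have h := lintegral_mul_sq_le (volume.restrict s) (hm.mul f.measurable_enorm).aemeasurable
    (hm.mul g.measurable_enorm).aemeasurable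
  simp only [Pi.mul_apply, mul_pow, hsq] at h
  refine (le_of_eq ?_).trans (h.trans (mul_le_mul_right
    ((setLIntegral_le_lintegral _ _).trans g.lintegral_log_sq_le) _))
  congr 1
  refine lintegral_congr fun x => ?_
  rw [mul_mul_mul_comm, ← sq, hsq]

theorem lintegral_elogWeight_mul_le (f g : X) :
    ∫⁻ x, elogWeight x * (‖f x‖ₑ * ‖g x‖ₑ) ≤ ‖f‖ₑ * ‖g‖ₑ := by
  refine ennreal_le_of_sq_le ?_
  have h := lintegral_restrict_elogWeight_mul_sq_le univ f g
  simp only [Measure.restrict_univ] at h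
  rw [mul_pow]
  exact h.trans (mul_le_mul_left f.lintegral_log_sq_le _)

/-- The weighted integral of a product is controlled by the `L²` norm of one factor, up to a small
multiple of its norm in `X`. -/
theorem exists_lintegral_elogWeight_mul_le (u : X) {ε : ℝ≥0} (hε : 0 < ε) :
    ∃ C : ℝ≥0, ∀ g : X,
      ∫⁻ x, elogWeight x * (‖u x‖ₑ * ‖g x‖ₑ) ≤ C * ‖toL2L g‖ₑ + ε * ‖g‖ₑ := by
  have hfin : ∫⁻ x, elogWeight x * ‖u x‖ₑ ^ 2 ≠ ⊤ :=
    (u.lintegral_log_sq_le.trans_lt (by simp)).ne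
  -- The tails of the finite measure with density `log (1 + |x|) u²` vanish; inside the ball the
  -- weight is bounded by `log (1 + n)`.
  have hlim : Tendsto (fun n : ℕ => ∫⁻ x in (Metric.closedBall (0 : Plane) n)ᶜ,
      elogWeight x * ‖u x‖ₑ ^ 2) atTop (𝓝 0) := by
    let ν : Measure Plane := volume.withDensity fun x => elogWeight x * ‖u x‖ₑ ^ 2
    have hν : ν univ ≠ ⊤ := by
      rwa [withDensity_apply _ MeasurableSet.univ, Measure.restrict_univ]
    have h := tendsto_measure_iInter_atTop (μ := ν)
      (s := fun n : ℕ => (Metric.closedBall (0 : Plane) n)ᶜ)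
      (fun n => measurableSet_closedBall.compl.nullMeasurableSet)
      (fun m n hmn => compl_subset_compl.2
        (Metric.closedBall_subset_closedBall (by exact_mod_cast hmn)))
      ⟨0, measure_ne_top_of_subset (subset_univ _) hν⟩
    rw [← compl_iUnion, Metric.iUnion_closedBall_nat, compl_univ, measure_empty] at h
    refine h.congr fun n => ?_
    exact withDensity_apply _ measurableSet_closedBall.compl
  obtain ⟨n, hn⟩ := (hlim.eventually_le_const (u := (ε : ℝ≥0∞) ^ 2) (by positivity)).exists
  refine ⟨(Real.log (1 + n)).toNNReal * ‖u‖₊, fun g => ?_⟩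
  rw [← lintegral_add_compl _ (measurableSet_closedBall (x := (0 : Plane)) (ε := n))]
  refine add_le_add ?_ ?_
  · calc ∫⁻ x in Metric.closedBall (0 : Plane) n, elogWeight x * (‖u x‖ₑ * ‖g x‖ₑ)
        ≤ ∫⁻ x in Metric.closedBall (0 : Plane) n,
            (Real.log (1 + n)).toNNReal * (‖u x‖ₑ * ‖g x‖ₑ) := by
          refine setLIntegral_mono' measurableSet_closedBall fun x hx => ?_
          refine mul_le_mul_left (ENNReal.ofReal_le_ofReal ?_) _
          exact Real.log_le_log (by positivity) (by linarith [mem_closedBall_zero_iff.1 hx])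
      _ ≤ (Real.log (1 + n)).toNNReal * (‖toL2L u‖ₑ * ‖toL2L g‖ₑ) := by
          rw [lintegral_const_mul' _ _ (by simp)]
          exact mul_le_mul_right ((setLIntegral_le_lintegral _ _).trans (lintegral_mul_le u g)) _
      _ ≤ _ := by
          push_cast
          rw [mul_assoc]
          exact mul_le_mul_right (mul_le_mul_left u.enorm_toL2L_le _) _
  · refine ennreal_le_of_sq_le ((lintegral_restrict_elogWeight_mul_sq_le _ u g).trans ?_)
    rw [mul_pow]
    exact mul_le_mul_left hn _

/-- Two applications of Cauchy–Schwarz: the singular part is in `L²`, with norm independent of the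
translation `z`, and `f g` is in `L²` since `f, g ∈ L⁴`. -/
theorem exists_lintegral_elogSingular_mul_le : ∃ C : ℝ≥0, ∀ (f g : X) (z : Plane),
    ∫⁻ x, elogSingular (x - z) * (‖f x‖ₑ * ‖g x‖ₑ) ≤ C * (‖f‖ₑ * ‖g‖ₑ) := by
  obtain ⟨C, hC⟩ := exists_lintegral_pow_four_le
  have h4 : ∀ f : X, ∫⁻ x, ‖f x‖ₑ ^ 4 ≤ C * 2 * ‖f‖ₑ ^ 4 := fun f => by
    refine (hC f f.grad f.grad_hasWeakGradient f.memLp f.grad_memLp).trans ?_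
    rw [mul_assoc]
    refine mul_le_mul_right ((mul_le_mul' f.lintegral_sq_le
      (add_le_add f.lintegral_sq_le f.lintegral_grad_sq_le)).trans_eq ?_) _
    ring
  have hL := lintegral_elogSingular_sq_lt_top
  set L := ∫⁻ z, elogSingular z ^ 2 with hLdef
  -- The bound holds for the squares with constant `L * (C * 2)`; adding `1` makes its square
  -- dominate this and avoids a square root.
  refine ⟨(L * (C * 2) + 1).toNNReal, fun f g z => ?_⟩
  have hfin : L * (C * 2) + 1 ≠ ⊤ := by finiteness
  rw [ENNReal.coe_toNNReal hfin]
  refine ennreal_le_of_sq_le ?_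
  have hs : Measurable fun x => elogSingular (x - z) :=
    measurable_elogSingular.comp (measurable_sub_const z)
  have h1 := lintegral_mul_sq_le volume hs.aemeasurable
    (f.measurable_enorm.mul g.measurable_enorm).aemeasurable
  have h2 := lintegral_mul_sq_le volume (f.measurable_enorm.pow_const 2).aemeasurable
    (g.measurable_enorm.pow_const 2).aemeasurable
  simp only [← pow_mul] at h2
  have h3 : ∫⁻ x, ‖f x‖ₑ ^ 2 * ‖g x‖ₑ ^ 2 ≤ C * 2 * (‖f‖ₑ * ‖g‖ₑ) ^ 2 := by
    refine ennreal_le_of_sq_le (h2.trans ((mul_le_mul' (h4 f) (h4 g)).trans_eq ?_))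
    ring
  rw [lintegral_sub_right_eq_self (fun x => elogSingular x ^ 2) z] at h1
  simp only [Pi.mul_apply, mul_pow ‖f _‖ₑ] at h1
  refine h1.trans ((mul_le_mul_right h3 _).trans ?_)
  rw [← mul_assoc, mul_pow (L * (C * 2) + 1)]
  have h5 : L * (C * 2) ≤ (L * (C * 2) + 1) ^ 2 :=
    le_self_add.trans (le_self_pow₀ (M₀ := ℝ≥0∞) le_add_self two_ne_zero)
  exact mul_le_mul_left h5 _

/-- The density `F` is left free: with `F = |h k|` this gives boundedness of the quartic form, and
with `F = |u φ|` it gives the finer estimate needed for compactness. -/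
theorem exists_lintegral_log_mul_le : ∃ C : ℝ≥0, ∀ (f g : X) (F : Plane → ℝ≥0∞), Measurable F →
    ∫⁻ p : Plane × Plane, ‖Real.log ‖p.1 - p.2‖‖ₑ * (‖f p.1‖ₑ * ‖g p.1‖ₑ) * F p.2 ≤
      ‖f‖ₑ * ‖g‖ₑ * (C * (∫⁻ y, F y) + ∫⁻ y, elogWeight y * F y) := by
  obtain ⟨C, hC⟩ := exists_lintegral_elogSingular_mul_le
  refine ⟨1 + C, fun f g F hF => ?_⟩
  have hfg : Measurable fun x => ‖f x‖ₑ * ‖g x‖ₑ := f.measurable_enorm.mul g.measurable_enorm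
  have hlog : Measurable fun p : Plane × Plane => ‖Real.log ‖p.1 - p.2‖‖ₑ :=
    (Real.measurable_log.comp (measurable_fst.sub measurable_snd).norm).enorm
  have hs : ∀ y, Measurable fun x => elogSingular (x - y) := fun y =>
    measurable_elogSingular.comp (measurable_sub_const y)
  have hw := measurable_elogWeight
  have hpt : ∀ y, ∫⁻ x, ‖Real.log ‖x - y‖‖ₑ * (‖f x‖ₑ * ‖g x‖ₑ) * F y ≤
      ‖f‖ₑ * ‖g‖ₑ * ((1 + C : ℝ≥0) * F y + elogWeight y * F y) := fun y => by
    calc ∫⁻ x, ‖Real.log ‖x - y‖‖ₑ * (‖f x‖ₑ * ‖g x‖ₑ) * F y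
        ≤ ∫⁻ x, (elogWeight x * (‖f x‖ₑ * ‖g x‖ₑ) + elogWeight y * (‖f x‖ₑ * ‖g x‖ₑ) +
            elogSingular (x - y) * (‖f x‖ₑ * ‖g x‖ₑ)) * F y := by
          refine lintegral_mono fun x => ?_
          rw [← add_mul, ← add_mul]
          exact mul_le_mul_left (mul_le_mul_left (enorm_log_le x y) _) _
      _ = ((∫⁻ x, elogWeight x * (‖f x‖ₑ * ‖g x‖ₑ)) + elogWeight y * (∫⁻ x, ‖f x‖ₑ * ‖g x‖ₑ) +
            ∫⁻ x, elogSingular (x - y) * (‖f x‖ₑ * ‖g x‖ₑ)) * F y := by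
          rw [lintegral_mul_const, lintegral_add_left, lintegral_add_left,
            lintegral_const_mul _ hfg]
          · exact hw.mul hfg
          · exact (hw.mul hfg).add (hfg.const_mul _)
          · exact ((hw.mul hfg).add (hfg.const_mul _)).add ((hs y).mul hfg)
      _ ≤ (‖f‖ₑ * ‖g‖ₑ + elogWeight y * (‖f‖ₑ * ‖g‖ₑ) + C * (‖f‖ₑ * ‖g‖ₑ)) * F y := by
          refine mul_le_mul_left (add_le_add (add_le_add ?_ ?_) (hC f g y)) _
          · exact lintegral_elogWeight_mul_le f g
          · exact mul_le_mul_right (lintegral_mul_le' f g) _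
      _ = _ := by
          push_cast
          ring
  rw [Measure.volume_eq_prod, lintegral_prod_symm']
  · refine (lintegral_mono hpt).trans_eq ?_
    rw [lintegral_const_mul, lintegral_add_left, lintegral_const_mul _ hF]
    · exact hF.const_mul _
    · exact (hF.const_mul _).add (hw.mul hF)
  · exact (hlog.mul (hfg.comp measurable_fst)).mul (hF.comp measurable_snd)

theorem exists_lintegral_log_mul_mul_le : ∃ C : ℝ≥0, ∀ f g h k : X,
    ∫⁻ p : Plane × Plane, ‖Real.log ‖p.1 - p.2‖‖ₑ * (‖f p.1‖ₑ * ‖g p.1‖ₑ) *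
      (‖h p.2‖ₑ * ‖k p.2‖ₑ) ≤ C * (‖f‖ₑ * ‖g‖ₑ * (‖h‖ₑ * ‖k‖ₑ)) := by
  obtain ⟨C, hC⟩ := exists_lintegral_log_mul_le
  refine ⟨C + 1, fun f g h k => (hC f g _ (h.measurable_enorm.mul k.measurable_enorm)).trans ?_⟩
  rw [mul_left_comm]
  refine mul_le_mul_right ?_ _
  push_cast
  rw [add_mul, one_mul]
  exact add_le_add (mul_le_mul_right (lintegral_mul_le' h k) _) (lintegral_elogWeight_mul_le h k)

/-- By `enorm_log_sub_le` the `y`-integral is bounded uniformly in `x`, so only the unweighted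
integral of `F` appears. -/
theorem exists_lintegral_log_sub_mul_le : ∃ C : ℝ≥0, ∀ (u : X) (F : Plane → ℝ≥0∞), Measurable F →
    ∫⁻ p : Plane × Plane, ‖Real.log ‖p.1 - p.2‖ - Real.log (1 + ‖p.1‖)‖ₑ * ‖u p.2‖ₑ ^ 2 * F p.1 ≤
      C * ‖u‖ₑ ^ 2 * ∫⁻ x, F x := by
  obtain ⟨C, hC⟩ := exists_lintegral_elogSingular_mul_le
  refine ⟨2 + C, fun u F hF => ?_⟩
  have huu : Measurable fun y => ‖u y‖ₑ * ‖u y‖ₑ := u.measurable_enorm.mul u.measurable_enorm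
  have hlog : Measurable fun p : Plane × Plane =>
      ‖Real.log ‖p.1 - p.2‖ - Real.log (1 + ‖p.1‖)‖ₑ :=
    ((Real.measurable_log.comp (measurable_fst.sub measurable_snd).norm).sub
      (measurable_log_weight.comp measurable_fst)).enorm
  have hs : ∀ x, Measurable fun y => elogSingular (y - x) := fun x =>
    measurable_elogSingular.comp (measurable_sub_const x)
  have hw := measurable_elogWeight
  have hpt : ∀ x, ∫⁻ y, ‖Real.log ‖x - y‖ - Real.log (1 + ‖x‖)‖ₑ * ‖u y‖ₑ ^ 2 * F x ≤
      (2 + C : ℝ≥0) * ‖u‖ₑ ^ 2 * F x := fun x => by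
    calc ∫⁻ y, ‖Real.log ‖x - y‖ - Real.log (1 + ‖x‖)‖ₑ * ‖u y‖ₑ ^ 2 * F x
        ≤ ∫⁻ y, (elogWeight y * (‖u y‖ₑ * ‖u y‖ₑ) + ‖u y‖ₑ * ‖u y‖ₑ +
            elogSingular (y - x) * (‖u y‖ₑ * ‖u y‖ₑ)) * F x := by
          refine lintegral_mono fun y => ?_
          rw [← add_one_mul, ← add_mul, ← elogSingular_sub_comm, sq]
          exact mul_le_mul_left (mul_le_mul_left (enorm_log_sub_le x y) _) _
      _ = ((∫⁻ y, elogWeight y * (‖u y‖ₑ * ‖u y‖ₑ)) + (∫⁻ y, ‖u y‖ₑ * ‖u y‖ₑ) +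
            ∫⁻ y, elogSingular (y - x) * (‖u y‖ₑ * ‖u y‖ₑ)) * F x := by
          rw [lintegral_mul_const, lintegral_add_left, lintegral_add_left]
          · exact hw.mul huu
          · exact (hw.mul huu).add huu
          · exact ((hw.mul huu).add huu).add ((hs x).mul huu)
      _ ≤ (‖u‖ₑ * ‖u‖ₑ + ‖u‖ₑ * ‖u‖ₑ + C * (‖u‖ₑ * ‖u‖ₑ)) * F x := by
          refine mul_le_mul_left (add_le_add (add_le_add ?_ ?_) (hC u u x)) _
          · exact lintegral_elogWeight_mul_le u u
          · exact lintegral_mul_le' u u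
      _ = _ := by
          push_cast
          ring
  rw [Measure.volume_eq_prod, lintegral_prod]
  · refine (lintegral_mono hpt).trans_eq ?_
    rw [lintegral_const_mul _ hF]
  · exact ((hlog.mul ((u.measurable_enorm.pow_const 2).comp measurable_snd)).mul
      (hF.comp measurable_fst)).aemeasurable

end X

/-! ### Derivatives of quartic polynomials on a normed space -/

section QuarticForm

variable {V : Type*} [NormedAddCommGroup V] [NormedSpace ℝ V]

/-- A bounded 4-linear form with the symmetries of the tensor product of two quadratic forms. -/
structure IsQuarticForm (Q : V → V → V → V → ℝ) : Prop where
  add_left : ∀ f f' g h k, Q (f + f') g h k = Q f g h k + Q f' g h k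
  smul_left : ∀ (c : ℝ) f g h k, Q (c • f) g h k = c * Q f g h k
  comm_left : ∀ f g h k, Q f g h k = Q g f h k
  swap : ∀ f g h k, Q f g h k = Q h k f g
  bound : ∃ C : ℝ, 0 ≤ C ∧ ∀ f g h k, ‖Q f g h k‖ ≤ C * ‖f‖ * ‖g‖ * ‖h‖ * ‖k‖

variable {Q : V → V → V → V → ℝ}

namespace IsQuarticForm

theorem comm_right (hQ : IsQuarticForm Q) (f g h k : V) : Q f g h k = Q f g k h := by
  rw [hQ.swap, hQ.comm_left, hQ.swap]

theorem exists_clm (hQ : IsQuarticForm Q) : ∃ T : V →L[ℝ] V →L[ℝ] V →L[ℝ] V →L[ℝ] ℝ,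
    ∀ f g h k, T f g h k = Q f g h k := by
  obtain ⟨C, hC0, hC⟩ := hQ.bound
  have add2 : ∀ f g g' h k, Q f (g + g') h k = Q f g h k + Q f g' h k := fun f g g' h k => by
    simp only [hQ.comm_left f, hQ.add_left]
  have smul2 : ∀ (c : ℝ) f g h k, Q f (c • g) h k = c * Q f g h k :=
    fun c f g h k => by simp only [hQ.comm_left f, hQ.smul_left]
  let T₂ : V → V → V →L[ℝ] V →L[ℝ] ℝ := fun f g =>
    LinearMap.mkContinuous₂ (LinearMap.mk₂ ℝ (fun h k => Q f g h k)
      (fun h h' k => by simp only [hQ.swap f g, hQ.add_left])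
      (fun c h k => by simp only [hQ.swap f g, hQ.smul_left, smul_eq_mul])
      (fun h k k' => by simp only [hQ.swap f g, add2])
      (fun c h k => by simp only [hQ.swap f g, smul2, smul_eq_mul]))
      (C * ‖f‖ * ‖g‖) (fun h k => hC f g h k)
  have hT₂ : ∀ f g h k, T₂ f g h k = Q f g h k := fun _ _ _ _ => rfl
  refine ⟨LinearMap.mkContinuous₂ (LinearMap.mk₂ ℝ T₂ (fun f f' g => ?_) (fun c f g => ?_)
    (fun f g g' => ?_) (fun c f g => ?_)) C (fun f g => ?_), fun _ _ _ _ => rfl⟩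
  · ext h k
    simp [hT₂, hQ.add_left]
  · ext h k
    simp [hT₂, hQ.smul_left]
  · ext h k
    simp [hT₂, add2]
  · ext h k
    simp [hT₂, smul2]
  · exact LinearMap.mkContinuous₂_norm_le _ (by positivity) (fun h k => hC f g h k)

variable {H : V →L[ℝ] V →L[ℝ] ℝ} {c : ℝ} {e : V → ℝ}

theorem contDiff (hQ : IsQuarticForm Q) (he : ∀ u, e u = 1 / 2 * H u u + c * Q u u u u)
    {n : ℕ∞ω} : ContDiff ℝ n e := by
  obtain ⟨T, hT⟩ := hQ.exists_clm
  have : e = fun u => 1 / 2 * H u u + c * T u u u u := by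
    funext u
    rw [he, hT]
  rw [this]
  fun_prop

/-- By symmetry the four slots contribute equally to the first derivative, `4 c Q(u, u, u, ·)`. In
the second, the first two slots coincide and the third gives `Q(u, u, φ, ψ)`. -/
theorem fderiv_fderiv_apply (hQ : IsQuarticForm Q) (hH : ∀ u v, H u v = H v u)
    (he : ∀ u, e u = 1 / 2 * H u u + c * Q u u u u) (u φ ψ : V) :
    fderiv ℝ (fderiv ℝ e) u φ ψ = H φ ψ + 4 * c * (Q u u φ ψ + 2 * Q u φ u ψ) := by
  obtain ⟨T, hT⟩ := hQ.exists_clm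
  have h0 : e = fun u => 1 / 2 * H u u + c * T u u u u := by
    funext u
    rw [he, hT]
  have h1 : fderiv ℝ e = fun u => H u + (4 * c) • T u u u := by
    funext u
    have hid := hasFDerivAt_id (𝕜 := ℝ) u
    have h1 := ((H.hasFDerivAt (x := u)).clm_apply hid).const_mul (1 / 2)
    have h2 := ((((T.hasFDerivAt (x := u)).clm_apply hid).clm_apply hid).clm_apply hid).const_mul c
    rw [h0]
    refine (h1.add h2).fderiv.trans ?_
    ext φ
    have e1 : Q φ u u u = Q u u u φ := by rw [hQ.swap, hQ.comm_right]
    have e2 : Q u φ u u = Q u u u φ := hQ.swap _ _ _ _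
    have e3 : Q u u φ u = Q u u u φ := hQ.comm_right _ _ _ _
    simp [hT, e1, e2, e3, hH φ u]
    ring
  rw [h1]
  have hid := hasFDerivAt_id (𝕜 := ℝ) u
  have h2 := (((T.hasFDerivAt (x := u)).clm_apply hid).clm_apply hid).const_smul (4 * c)
  have h3 : HasFDerivAt (fun u => H u + (4 * c) • T u u u) _ u := (H.hasFDerivAt (x := u)).add h2
  rw [h3.fderiv]
  simp [hT, hQ.comm_left φ u]
  ring

end IsQuarticForm

end QuarticForm

/-! ### The energy as a quartic polynomial on `X` -/

namespace X

/-- The integrand of the logarithmic interaction of `f g` and `h k`. -/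
def logIntegrand (f g h k : X) (p : Plane × Plane) : ℝ :=
  Real.log ‖p.1 - p.2‖ * (f p.1 * g p.1) * (h p.2 * k p.2)

/-- The logarithmic interaction `∬ log |x - y| f(x) g(x) h(y) k(y) dx dy`. -/
def logIntegral (f g h k : X) : ℝ := ∫ p, logIntegrand f g h k p

theorem enorm_logIntegrand (f g h k : X) (p : Plane × Plane) : ‖logIntegrand f g h k p‖ₑ =
    ‖Real.log ‖p.1 - p.2‖‖ₑ * (‖f p.1‖ₑ * ‖g p.1‖ₑ) * (‖h p.2‖ₑ * ‖k p.2‖ₑ) := by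
  simp only [logIntegrand, enorm_mul]

theorem measurable_logIntegrand (f g h k : X) : Measurable (logIntegrand f g h k) :=
  ((Real.measurable_log.comp (measurable_fst.sub measurable_snd).norm).mul
    ((f.measurable.mul g.measurable).comp measurable_fst)).mul
    ((h.measurable.mul k.measurable).comp measurable_snd)

theorem integrable_logIntegrand (f g h k : X) : Integrable (logIntegrand f g h k) := by
  obtain ⟨C, hC⟩ := exists_lintegral_log_mul_mul_le
  refine ⟨(measurable_logIntegrand f g h k).aestronglyMeasurable, ?_⟩
  simp only [HasFiniteIntegral, enorm_logIntegrand]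
  exact (hC f g h k).trans_lt (by finiteness)

theorem exists_norm_logIntegral_le :
    ∃ C : ℝ≥0, ∀ f g h k : X, ‖logIntegral f g h k‖ ≤ C * ‖f‖ * ‖g‖ * ‖h‖ * ‖k‖ := by
  obtain ⟨C, hC⟩ := exists_lintegral_log_mul_mul_le
  refine ⟨C, fun f g h k => ?_⟩
  have h1 := (enorm_integral_le_lintegral_enorm (μ := volume) (logIntegrand f g h k))
  simp only [enorm_logIntegrand] at h1
  have h2 := h1.trans (hC f g h k)
  simp only [enorm_eq_nnnorm] at h2
  norm_cast at h2
  have h3 : ‖logIntegral f g h k‖ ≤ C * (‖f‖ * ‖g‖ * (‖h‖ * ‖k‖)) := by exact_mod_cast h2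
  linarith

theorem logIntegral_swap (f g h k : X) : logIntegral f g h k = logIntegral h k f g := by
  rw [logIntegral, Measure.volume_eq_prod, ← integral_prod_swap]
  refine integral_congr_ae (Eventually.of_forall fun p => ?_)
  simp only [logIntegrand, Prod.fst_swap, Prod.snd_swap, norm_sub_rev p.2]
  ring

theorem logIntegral_comm_left (f g h k : X) : logIntegral f g h k = logIntegral g f h k := by
  simp only [logIntegral, logIntegrand, mul_comm (f _)]

theorem logIntegral_comm_right (f g h k : X) : logIntegral f g h k = logIntegral f g k h := by
  simp only [logIntegral, logIntegrand, mul_comm (h _)]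

theorem logIntegral_add_left (f f' g h k : X) :
    logIntegral (f + f') g h k = logIntegral f g h k + logIntegral f' g h k := by
  rw [logIntegral, logIntegral, logIntegral, ← integral_add (integrable_logIntegrand f g h k)
    (integrable_logIntegrand f' g h k)]
  refine integral_congr_ae ?_
  have h1 : ∀ᵐ p : Plane × Plane, (f + f' : X) p.1 = f p.1 + f' p.1 :=
    Measure.quasiMeasurePreserving_fst.ae (coe_add f f')
  filter_upwards [h1] with p hp
  simp only [logIntegrand, hp]
  ring

theorem logIntegral_smul_left (c : ℝ) (f g h k : X) :
    logIntegral (c • f) g h k = c * logIntegral f g h k := by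
  rw [logIntegral, logIntegral, ← integral_const_mul]
  refine integral_congr_ae ?_
  have h1 : ∀ᵐ p : Plane × Plane, (c • f : X) p.1 = c * f p.1 :=
    Measure.quasiMeasurePreserving_fst.ae (coe_smul c f)
  filter_upwards [h1] with p hp
  simp only [logIntegrand, hp]
  ring

theorem isQuarticForm_logIntegral : IsQuarticForm logIntegral where
  add_left := logIntegral_add_left
  smul_left := logIntegral_smul_left
  comm_left := logIntegral_comm_left
  swap := logIntegral_swap
  bound := by
    obtain ⟨C, hC⟩ := exists_norm_logIntegral_le
    exact ⟨C, C.2, hC⟩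

/-- The scalar product of `H¹` on `X`, as a bounded bilinear form. -/
def h1Form : X →L[ℝ] X →L[ℝ] ℝ :=
  (innerSL ℝ).bilinearComp gradL gradL + (innerSL ℝ).bilinearComp toL2L toL2L

/-- The weighted `L²` scalar product on `X`, as a bounded bilinear form. -/
def weightForm : X →L[ℝ] X →L[ℝ] ℝ := (innerSL ℝ).bilinearComp weightL weightL

theorem h1Form_eq_inner (u v : X) :
    h1Form u v = ⟪gradₗ u, gradₗ v⟫_ℝ + ⟪toL2ₗ u, toL2ₗ v⟫_ℝ := rfl

theorem h1Form_apply (u v : X) :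
    h1Form u v = ∫ x, (⟪u.grad x, v.grad x⟫_ℝ + u x * v x) := (integral_h1_eq u v).symm

theorem weightForm_eq_inner (u v : X) : weightForm u v = ⟪weightₗ u, weightₗ v⟫_ℝ := rfl

theorem weightForm_apply (u v : X) :
    weightForm u v = ∫ x, Real.log (1 + ‖x‖) * (u x * v x) := inner_weightₗ u v

theorem h1Form_comm (u v : X) : h1Form u v = h1Form v u := by
  simp only [h1Form_eq_inner, real_inner_comm]

end X

open X

theorem energy_eq (u : X) :
    energy u = 1 / 2 * h1Form u u + 1 / (8 * Real.pi) * logIntegral u u u u := by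
  simp only [energy, h1Form_apply, real_inner_self_eq_norm_sq, ← sq, logIntegral, logIntegrand]

theorem contDiff_energy {n : ℕ∞ω} : ContDiff ℝ n energy :=
  isQuarticForm_logIntegral.contDiff energy_eq

theorem energyHessian_apply (u φ ψ : X) : energyHessian u φ ψ =
    h1Form φ ψ + 1 / (2 * Real.pi) * (logIntegral u u φ ψ + 2 * logIntegral u φ u ψ) := by
  refine (isQuarticForm_logIntegral.fderiv_fderiv_apply h1Form_comm energy_eq u φ ψ).trans ?_
  congr 2
  field_simp
  norm_num

/-! ### The splitting of the Hessian into a coercive and a compact part -/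

namespace X

/-- The interaction of `u²` and `φ ψ` with the kernel `log |x - y| - log (1 + |x|)`. -/
def logSubIntegral (u φ ψ : X) : ℝ := ∫ p : Plane × Plane,
  (Real.log ‖p.1 - p.2‖ - Real.log (1 + ‖p.1‖)) * u p.2 ^ 2 * (φ p.1 * ψ p.1)

/-- The part of the kernel depending on `x` alone factors by Fubini; it is the term transferred to
the coercive operator. -/
theorem logSubIntegral_eq (u φ ψ : X) : logSubIntegral u φ ψ =
    logIntegral u u φ ψ - (∫ y, u y ^ 2) * weightForm φ ψ := by
  have h1 : Integrable (fun p : Plane × Plane =>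
      Real.log (1 + ‖p.1‖) * (φ p.1 * ψ p.1) * u p.2 ^ 2) :=
    (integrable_log_mul φ.memX ψ.memX).mul_prod u.memLp.integrable_sq
  have h2 : ∫ p : Plane × Plane, Real.log (1 + ‖p.1‖) * (φ p.1 * ψ p.1) * u p.2 ^ 2 =
      weightForm φ ψ * ∫ y, u y ^ 2 := by
    rw [weightForm_apply]
    exact integral_prod_mul (fun x : Plane => Real.log (1 + ‖x‖) * (φ x * ψ x)) fun y => u y ^ 2
  rw [mul_comm, ← h2, logIntegral_swap, logIntegral,
    ← integral_sub (integrable_logIntegrand φ ψ u u) h1]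
  refine integral_congr_ae (Eventually.of_forall fun p => ?_)
  simp only [logIntegrand]
  ring

theorem exists_norm_logSubIntegral_le : ∃ C : ℝ≥0, ∀ u φ ψ : X,
    ‖logSubIntegral u φ ψ‖ ≤ C * ‖u‖ ^ 2 * ‖toL2L φ‖ * ‖ψ‖ := by
  obtain ⟨C, hC⟩ := exists_lintegral_log_sub_mul_le
  refine ⟨C, fun u φ ψ => ?_⟩
  have h1 : ‖logSubIntegral u φ ψ‖ₑ ≤ C * ‖u‖ₑ ^ 2 * (‖toL2L φ‖ₑ * ‖ψ‖ₑ) := by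
    refine (enorm_integral_le_lintegral_enorm _).trans ?_
    simp only [enorm_mul, enorm_pow]
    refine (hC u _ (φ.measurable_enorm.mul ψ.measurable_enorm)).trans ?_
    exact mul_le_mul_right ((lintegral_mul_le φ ψ).trans
      (mul_le_mul_right ψ.enorm_toL2L_le _)) _
  simp only [enorm_eq_nnnorm] at h1
  norm_cast at h1
  have h2 : ‖logSubIntegral u φ ψ‖ ≤ C * ‖u‖ ^ 2 * (‖toL2L φ‖ * ‖ψ‖) := by exact_mod_cast h1
  rwa [← mul_assoc] at h2

/-- With `u ψ` and `u φ` on separate variables, the norm of `ψ` factors out. The weight on `u φ` is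
absorbed by the decay of `u`, leaving the `L²` norm of `φ` and a small remainder. -/
theorem exists_norm_logIntegral_le_toL2L (u : X) {ε : ℝ≥0} (hε : 0 < ε) :
    ∃ C : ℝ≥0, ∀ φ ψ : X,
      ‖logIntegral u ψ u φ‖ ≤ ‖u‖ * ‖ψ‖ * (C * ‖toL2L φ‖ + ε * ‖φ‖) := by
  obtain ⟨C, hC⟩ := exists_lintegral_log_mul_le
  obtain ⟨D, hD⟩ := u.exists_lintegral_elogWeight_mul_le hε
  refine ⟨C * ‖u‖₊ + D, fun φ ψ => ?_⟩
  have h1 : ‖logIntegral u ψ u φ‖ₑ ≤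
      ‖u‖ₑ * ‖ψ‖ₑ * (C * (‖u‖ₑ * ‖toL2L φ‖ₑ) + (D * ‖toL2L φ‖ₑ + ε * ‖φ‖ₑ)) := by
    refine (enorm_integral_le_lintegral_enorm _).trans ?_
    simp only [enorm_logIntegrand]
    refine (hC u ψ _ (u.measurable_enorm.mul φ.measurable_enorm)).trans ?_
    exact mul_le_mul_right (add_le_add (mul_le_mul_right ((lintegral_mul_le u φ).trans
      (mul_le_mul_left u.enorm_toL2L_le _)) _) (hD φ)) _
  simp only [enorm_eq_nnnorm] at h1
  norm_cast at h1
  have h2 : ‖logIntegral u ψ u φ‖ ≤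
      ‖u‖ * ‖ψ‖ * (C * (‖u‖ * ‖toL2L φ‖) + (D * ‖toL2L φ‖ + ε * ‖φ‖)) := by exact_mod_cast h1
  refine h2.trans_eq ?_
  push_cast
  ring

/-- The coercive part of the Hessian of the energy. -/
def hessianCoercive (u : X) : X →L[ℝ] StrongDual ℝ X :=
  h1Form + (1 / (2 * Real.pi) * ∫ y, u y ^ 2) • weightForm

/-- The compact part of the Hessian of the energy. -/
def hessianCompact (u : X) : X →L[ℝ] StrongDual ℝ X := energyHessian u - hessianCoercive u

theorem hessianCoercive_eq (u φ ψ : X) : hessianCoercive u φ ψ =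
    h1Form φ ψ + 1 / (2 * Real.pi) * (∫ y, u y ^ 2) * weightForm φ ψ := rfl

theorem hessianCoercive_apply (u φ ψ : X) : hessianCoercive u φ ψ =
    ∫ x, (⟪φ.grad x, ψ.grad x⟫_ℝ + φ x * ψ x
      + (1 / (2 * Real.pi) * ∫ y, u y ^ 2) * Real.log (1 + ‖x‖) * (φ x * ψ x)) := by
  simp only [mul_assoc _ (Real.log _)]
  rw [integral_add (integrable_h1 φ ψ) ((integrable_log_mul φ.memX ψ.memX).const_mul _),
    integral_const_mul, hessianCoercive_eq, h1Form_apply, weightForm_apply]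

theorem hessianCompact_eq (u φ ψ : X) : hessianCompact u φ ψ =
    1 / (2 * Real.pi) * logSubIntegral u φ ψ + 1 / Real.pi * logIntegral u ψ u φ := by
  have h : hessianCompact u φ ψ = energyHessian u φ ψ - hessianCoercive u φ ψ := rfl
  rw [h, energyHessian_apply, hessianCoercive_eq, logSubIntegral_eq, logIntegral_swap u ψ u φ]
  have := Real.pi_ne_zero
  field_simp
  ring

theorem integral_sq_pos {u : X} (hpos : ∀ᵐ x, 0 < u x) : 0 < ∫ y, u y ^ 2 := by
  rw [integral_pos_iff_support_of_nonneg (fun x => sq_nonneg _) u.memLp.integrable_sq]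
  have : Function.support (fun y => u y ^ 2) =ᵐ[volume] (univ : Set Plane) := by
    refine eventuallyEq_univ.2 ?_
    filter_upwards [hpos] with x hx
    exact pow_ne_zero 2 hx.ne'
  rw [measure_congr this]
  simp

theorem isCoercive_hessianCoercive {u : X} (hpos : ∀ᵐ x, 0 < u x) :
    IsCoercive (hessianCoercive u) := by
  have hc : 0 < 1 / (2 * Real.pi) * ∫ y, u y ^ 2 := by
    have := integral_sq_pos hpos
    positivity
  -- The `H¹` part has coefficient `1` and the weighted part `c²`, so the smaller of the two is a
  -- coercivity constant.
  refine ⟨min 1 (1 / (2 * Real.pi) * ∫ y, u y ^ 2), lt_min one_pos hc, fun φ => ?_⟩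
  rw [hessianCoercive_eq, h1Form_eq_inner, weightForm_eq_inner, real_inner_self_eq_norm_sq,
    real_inner_self_eq_norm_sq, real_inner_self_eq_norm_sq, mul_assoc, ← sq, norm_sq_eq_add,
    mul_add]
  refine add_le_add ((mul_le_mul_of_nonneg_right (min_le_left _ _) (by positivity)).trans_eq
    (one_mul _)) (mul_le_mul_of_nonneg_right (min_le_right _ _) (by positivity))

theorem isCompactOperator_hessianCompact (u : X) : IsCompactOperator (hessianCompact u) := by
  refine isCompactOperator_of_forall_le (hessianCompact u) fun ε hε => ?_
  -- The remainder comes multiplied by `‖u‖`, and `‖u‖ * (ε / (‖u‖ + 1)) ≤ ε`; the `+ 1` covers `u =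
  -- 0`.
  have hδ : 0 < ε / (‖u‖ + 1) := by positivity
  obtain ⟨C, hC⟩ := exists_norm_logSubIntegral_le
  obtain ⟨D, hD⟩ := u.exists_norm_logIntegral_le_toL2L (ε := ⟨_, hδ.le⟩) hδ
  let M : ℝ := C * ‖u‖ ^ 2 + ‖u‖ * D
  have hM : 0 ≤ M := by positivity
  refine ⟨Lp ℝ 2 (volume : Measure Plane), inferInstance, inferInstance, M • toL2L,
    isCompactOperator_toL2L.smul M, fun φ => ?_⟩
  have hS : ‖(M • toL2L) φ‖ = M * ‖toL2L φ‖ := by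
    rw [smul_apply, norm_smul, Real.norm_of_nonneg hM]
  rw [hS]
  refine ContinuousLinearMap.opNorm_le_bound _ (by positivity) fun ψ => ?_
  rw [hessianCompact_eq]
  have hpi := Real.pi_gt_three
  have h1 : ‖1 / (2 * Real.pi) * logSubIntegral u φ ψ‖ ≤ ‖logSubIntegral u φ ψ‖ := by
    rw [norm_mul, Real.norm_of_nonneg (by positivity)]
    exact mul_le_of_le_one_left (norm_nonneg _) ((div_le_one (by positivity)).2 (by linarith))
  have h2 : ‖1 / Real.pi * logIntegral u ψ u φ‖ ≤ ‖logIntegral u ψ u φ‖ := by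
    rw [norm_mul, Real.norm_of_nonneg (by positivity)]
    exact mul_le_of_le_one_left (norm_nonneg _) ((div_le_one (by positivity)).2 (by linarith))
  have h3 : ‖u‖ * (ε / (‖u‖ + 1)) ≤ ε := by
    rw [mul_div_assoc', div_le_iff₀ (by positivity)]
    nlinarith [norm_nonneg u]
  have h4 : ‖u‖ * (ε / (‖u‖ + 1)) * (‖φ‖ * ‖ψ‖) ≤ ε * (‖φ‖ * ‖ψ‖) :=
    mul_le_mul_of_nonneg_right h3 (by positivity)
  have h5 := hC u φ ψ
  have h6 : ‖logIntegral u ψ u φ‖ ≤ ‖u‖ * ‖ψ‖ * (D * ‖toL2L φ‖ + ε / (‖u‖ + 1) * ‖φ‖) := hD φ ψ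
  calc _ ≤ _ := norm_add_le _ _
    _ ≤ _ := add_le_add (h1.trans h5) (h2.trans h6)
    _ = M * ‖toL2L φ‖ * ‖ψ‖ + ‖u‖ * (ε / (‖u‖ + 1)) * (‖φ‖ * ‖ψ‖) := by ring
    _ ≤ M * ‖toL2L φ‖ * ‖ψ‖ + ε * (‖φ‖ * ‖ψ‖) := by gcongr
    _ = _ := by ring

theorem energyHessian_symm (u φ ψ : X) : energyHessian u φ ψ = energyHessian u ψ φ := by
  rw [energyHessian_apply, energyHessian_apply, h1Form_comm, logIntegral_comm_right,
    logIntegral_swap u φ]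

theorem energyHessian_eq_logForm (u φ ψ : X) : energyHessian u φ ψ =
    (∫ x, (⟪φ.grad x, ψ.grad x⟫_ℝ + φ x * ψ x))
      - logForm (fun x => u x ^ 2) (fun x => φ x * ψ x)
      - 2 * logForm (fun x => u x * φ x) (fun x => u x * ψ x) := by
  rw [energyHessian_apply, h1Form_apply]
  simp only [logForm, logIntegral, logIntegrand, sq]
  ring

end X

end LogChoquard

end

theorem mainTheorem2 (u : LogChoquard.X) (hpos : ∀ᵐ x, 0 < u x)
    (hsol : LogChoquard.IsWeakSolution u) :
    -- the double integrals below converge absolutely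
    (∀ f g h k : LogChoquard.X, Integrable (fun p : LogChoquard.Plane × LogChoquard.Plane =>
      Real.log ‖p.1 - p.2‖ * (f p.1 * g p.1) * (h p.2 * k p.2))) ∧
    -- `I` is of class `C²`, and `I''(u)` is given by the expected formula
    ContDiff ℝ 2 LogChoquard.energy ∧
    (∀ φ ψ : LogChoquard.X, LogChoquard.energyHessian u φ ψ =
      (∫ x, (⟪φ.grad x, ψ.grad x⟫_ℝ + φ x * ψ x))
        - LogChoquard.logForm (fun x => u x ^ 2) (fun x => φ x * ψ x)
        - 2 * LogChoquard.logForm (fun x => u x * φ x) (fun x => u x * ψ x)) ∧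
    -- `I''(u) : X → X*` is Fredholm of index zero
    (LogChoquard.energyHessian u).IsFredholm ∧
    LogChoquard.fredholmIndex (LogChoquard.energyHessian u) = 0 ∧
    -- the splitting `I''(u) = A + K`
    ∃ A K : LogChoquard.X →L[ℝ] StrongDual ℝ LogChoquard.X,
      LogChoquard.energyHessian u = A + K ∧
      (∀ φ ψ : LogChoquard.X, A φ ψ =
        ∫ x, (⟪φ.grad x, ψ.grad x⟫_ℝ + φ x * ψ x
          + (1 / (2 * Real.pi) * ∫ y, u y ^ 2) * Real.log (1 + ‖x‖) * (φ x * ψ x))) ∧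
      (∀ φ ψ : LogChoquard.X, K φ ψ =
        1 / (2 * Real.pi) * (∫ p : LogChoquard.Plane × LogChoquard.Plane,
          (Real.log ‖p.1 - p.2‖ - Real.log (1 + ‖p.1‖)) * u p.2 ^ 2 * (φ p.1 * ψ p.1))
        + 1 / Real.pi * ∫ p : LogChoquard.Plane × LogChoquard.Plane,
          Real.log ‖p.1 - p.2‖ * (u p.2 * φ p.2) * (u p.1 * ψ p.1)) ∧
      IsCoercive A ∧ A.IsInvertible ∧ IsCompactOperator K := by
  have hS : LogChoquard.energyHessian u = u.hessianCoercive + u.hessianCompact :=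
    (add_sub_cancel (LogChoquard.X.hessianCoercive u) (LogChoquard.energyHessian u)).symm
  have hA := LogChoquard.X.isCoercive_hessianCoercive hpos
  have hK := LogChoquard.X.isCompactOperator_hessianCompact u
  have hF := LogChoquard.isFredholm_of_coercive_add_compact hS hA hK u.energyHessian_symm
  refine ⟨LogChoquard.X.integrable_logIntegrand, LogChoquard.contDiff_energy,
    u.energyHessian_eq_logForm, hF.1, hF.2, u.hessianCoercive, u.hessianCompact, hS,
    u.hessianCoercive_apply, fun φ ψ => ?_, hA, hA.isInvertible, hK⟩
  rw [LogChoquard.X.hessianCompact_eq]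
  congr 2
  refine integral_congr_ae (Eventually.of_forall fun p => ?_)
  simp only [LogChoquard.X.logIntegrand]
  ring
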